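/- Let $n$ be a positive integer. For $i\ge 1$ and a tuple $\alpha=(i_1,\dots,i_t)$ of positive integers with $i_1+\dots+i_t=i$, let $\mathcal P^{(n)}_{\alpha}$ be the $S_n$-set of all $t$-tuples $(A_1,\dots,A_t)$ of pairwise disjoint subsets of $\{1,\dots,n\}$ with $|A_j|=i_j$, and define in the Burnside ring $B(S_n)$ $$\rho_i^{(n)}=\sum_{t=1}^{i}\ \sum_{\substack{(i_1,\dots,i_t)\\ i_1+\dots+i_t=i,\ i_s\ge 1}}(-1)^t\,[\mathcal P^{(n)}_{(i_1,\dots,i_t)}]\in B(S_n).$$ These elements are universal in the following sense. Let $k$ be any field with separable closure $k^s$ and absolute Galois group $G=\mathrm{Gal}(k^s/k)$, and let $L$ be any commutative separable $k$-algebra of dimension $n$. Let $K_0(\mathrm{Var}_k)$ be the Grothendieck ring of $k$-varieties (schemes of finite type over $k$), $\mathbb L$ the class of the affine line, and $L^*$ the torus representing $R\mapsto (L\otimes_k R)^\times$. The $G$-set $\mathrm{Hom}_k(L,k^s)$ has $n$ elements; any numbering of its elements defines a continuous homomorphism $G\to S_n$ and hence a restriction map $\mathrm{res}^{S_n}_G\colon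 B(S_n)\to B(G)$ between Burnside rings (of finite sets with continuous action). Let $\mathrm{art}_k\colon B(G)\to K_0(\mathrm{Var}_k)$ be the homomorphism sending the class of a finite continuous $G$-set $S$ to the class of the spectrum of the corresponding separable $k$-algebra $\mathrm{Hom}_G(S,k^s)$ of $G$-equivariant maps. Then, for every such numbering, $$[L^*]=\mathbb L^n+a_1\mathbb L^{n-1}+\dots+a_{n-1}\mathbb L+a_n\in K_0(\mathrm{Var}_k),\qquad a_i=\mathrm{art}_k\bigl(\mathrm{res}^{S_n}_G(\rho_i^{(n)})\bigr).$$ -/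

import Mathlib

open CategoryTheory AlgebraicGeometry MonoidalCategory
open scoped TensorProduct Pointwise

universe u v w

noncomputable section

/-! ## The Grothendieck ring of varieties -/

namespace GrothendieckVar

/-- The property of being a scheme of finite type over `Spec k`. -/
def finiteTypeOver (k : Type u) [Field k] : ObjectProperty (Over (Spec (CommRingCat.of k))) :=
  fun X => LocallyOfFiniteType X.hom ∧ QuasiCompact X.hom

instance (k : Type u) [Field k] : (finiteTypeOver k).IsMonoidal where
  prop_unit := by
    constructor
    · change LocallyOfFiniteType (𝟙 _)
      infer_instance
    · change QuasiCompact (𝟙 _)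
      infer_instance
  prop_tensor := by
    rintro X Y ⟨hX, hX'⟩ ⟨hY, hY'⟩
    constructor
    · rw [Over.tensorObj_hom]
      infer_instance
    · rw [Over.tensorObj_hom]
      infer_instance

/-- Varieties over `k`: schemes of finite type over `k`, with morphisms over `k`.
The monoidal structure is the fibre product over `Spec k`. -/
abbrev Variety (k : Type u) [Field k] : Type (u + 1) := (finiteTypeOver k).FullSubcategory

/-- The isomorphism classes of varieties over `k`, a commutative monoid under the
fibre product over `Spec k`. -/
abbrev IsoClass (k : Type u) [Field k] : Type (u + 1) := Skeleton (Variety k)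

/-- The scissor relations `[X] - [X ∖ Z] - [Z]`, where `Z` is a closed subscheme of `X`.
The complement `X ∖ Z` is the open subscheme of `X` supported on the complement of `Z`. -/
def scissorRelations (k : Type u) [Field k] : Set (FreeAbelianGroup (IsoClass k)) :=
  {x | ∃ (X Z U : Variety k) (i : Z ⟶ X) (j : U ⟶ X),
    IsClosedImmersion i.hom.left ∧ IsOpenImmersion j.hom.left ∧
    Set.range j.hom.left = (Set.range i.hom.left)ᶜ ∧
    x = FreeAbelianGroup.of (toSkeleton X) - FreeAbelianGroup.of (toSkeleton U)
      - FreeAbelianGroup.of (toSkeleton Z)}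

/-- The Grothendieck ring of varieties `K₀(Var_k)`. The multiplication on the free abelian
group is the bilinear extension of `[X] * [Y] = [X ×_k Y]`. The product of a scissor relation with
a variety is again a scissor relation, so that the ideal generated by the scissor relations is also
the subgroup generated by them. -/
abbrev K0Var (k : Type u) [Field k] : Type (u + 1) :=
  FreeAbelianGroup (IsoClass k) ⧸ Ideal.span (scissorRelations k)

/-- The class of a variety in the Grothendieck ring. -/
def K0Var.mk {k : Type u} [Field k] (X : Variety k) : K0Var k :=
  Ideal.Quotient.mk _ (FreeAbelianGroup.of (toSkeleton X))

theorem K0Var.mk_eq_of_iso {k : Type u} [Field k] {X Y : Variety k} (e : X ≅ Y) :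
    K0Var.mk X = K0Var.mk Y := by
  unfold K0Var.mk
  rw [show toSkeleton X = toSkeleton Y from Quotient.sound ⟨e⟩]

theorem K0Var.scissor {k : Type u} [Field k] {X Z U : Variety k} (i : Z ⟶ X) (j : U ⟶ X)
    (hi : IsClosedImmersion i.hom.left) (hj : IsOpenImmersion j.hom.left)
    (h : Set.range j.hom.left = (Set.range i.hom.left)ᶜ) :
    K0Var.mk X = K0Var.mk U + K0Var.mk Z := by
  have : (Ideal.Quotient.mk (Ideal.span (scissorRelations k))) (FreeAbelianGroup.of (toSkeleton X)
      - FreeAbelianGroup.of (toSkeleton U) - FreeAbelianGroup.of (toSkeleton Z)) = 0 :=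
    Ideal.Quotient.eq_zero_iff_mem.2 (Ideal.subset_span ⟨X, Z, U, i, j, hi, hj, h, rfl⟩)
  rw [map_sub, map_sub, sub_sub, sub_eq_zero] at this
  exact this

/-- The affine variety `Spec A` over `k`, for a `k`-algebra `A` of finite type. -/
def specVariety (k : Type u) [Field k] (A : Type u) [CommRing A] [Algebra k A]
    [Algebra.FiniteType k A] : Variety k :=
  ⟨Over.mk (Spec.map (CommRingCat.ofHom (algebraMap k A))), by
    constructor
    · change LocallyOfFiniteType (Spec.map (CommRingCat.ofHom (algebraMap k A)))
      rw [HasRingHomProperty.Spec_iff (P := @LocallyOfFiniteType)]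
      exact (RingHom.finiteType_algebraMap (A := k) (B := A)).2 inferInstance
    · change QuasiCompact (Spec.map (CommRingCat.ofHom (algebraMap k A)))
      infer_instance⟩

/-- The morphism of varieties attached to a homomorphism of `k`-algebras. -/
def specVarietyMap {k : Type u} [Field k] {A B : Type u} [CommRing A] [Algebra k A]
    [Algebra.FiniteType k A] [CommRing B] [Algebra k B] [Algebra.FiniteType k B] (f : A →ₐ[k] B) :
    specVariety k B ⟶ specVariety k A :=
  ObjectProperty.homMk (Over.homMk (Spec.map (CommRingCat.ofHom f.toRingHom)) (by
    change Spec.map _ ≫ Spec.map _ = Spec.map _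
    rw [← Spec.map_comp, ← CommRingCat.ofHom_comp]
    congr 2
    exact f.comp_algebraMap))

/-- The class of `Spec A` in the Grothendieck ring. -/
def specClass (k : Type u) [Field k] (A : Type u) [CommRing A] [Algebra k A]
    [Algebra.FiniteType k A] : K0Var k :=
  K0Var.mk (specVariety k A)

theorem specClass_congr {k : Type u} [Field k] {A B : Type u} [CommRing A] [Algebra k A]
    [Algebra.FiniteType k A] [CommRing B] [Algebra k B] [Algebra.FiniteType k B] (e : A ≃ₐ[k] B) :
    specClass k A = specClass k B := by
  refine K0Var.mk_eq_of_iso ⟨specVarietyMap e.symm.toAlgHom, specVarietyMap e.toAlgHom, ?_, ?_⟩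
  · ext : 2
    change Spec.map _ ≫ Spec.map _ = 𝟙 _
    rw [← Spec.map_comp, ← CommRingCat.ofHom_comp]
    rw [← Spec.map_id]
    congr 1
    ext x
    simp
  · ext : 2
    change Spec.map _ ≫ Spec.map _ = 𝟙 _
    rw [← Spec.map_comp, ← CommRingCat.ofHom_comp]
    rw [← Spec.map_id]
    congr 1
    ext x
    simp

theorem specClass_prod {k : Type u} [Field k] {A B : Type u} [CommRing A] [Algebra k A]
    [Algebra.FiniteType k A] [CommRing B] [Algebra k B] [Algebra.FiniteType k B] :
    specClass k (A × B) = specClass k A + specClass k B := by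
  have hA : Limits.coprod.inl ≫ coprodSpec A B = Spec.map (CommRingCat.ofHom (RingHom.fst A B)) :=
    coprodSpec_inl A B
  have hB : Limits.coprod.inr ≫ coprodSpec A B = Spec.map (CommRingCat.ofHom (RingHom.snd A B)) :=
    coprodSpec_inr A B
  refine K0Var.scissor (specVarietyMap (AlgHom.snd k A B)) (specVarietyMap (AlgHom.fst k A B))
    ?_ ?_ ?_
  · exact IsClosedImmersion.spec_of_surjective (CommRingCat.ofHom (RingHom.snd A B))
      Prod.snd_surjective
  · change IsOpenImmersion (Spec.map (CommRingCat.ofHom (RingHom.fst A B)))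
    rw [← hA]
    infer_instance
  · change Set.range (Spec.map (CommRingCat.ofHom (RingHom.fst A B))) =
      (Set.range (Spec.map (CommRingCat.ofHom (RingHom.snd A B))))ᶜ
    rw [← hA, ← hB]
    have h := isCompl_range_inl_inr (Spec (CommRingCat.of A)) (Spec (CommRingCat.of B))
    have hb : Function.Bijective (coprodSpec A B) := (coprodSpec A B).homeomorph.bijective
    rw [Scheme.Hom.comp_base, Scheme.Hom.comp_base, TopCat.coe_comp, TopCat.coe_comp,
      Set.range_comp, Set.range_comp, ← Set.image_compl_eq hb, h.symm.compl_eq]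

/-- The Lefschetz class `𝕃`: the class of the affine line `Spec k[X]`. -/
def lefschetz (k : Type u) [Field k] : K0Var k := specClass k (Polynomial k)

end GrothendieckVar

/-! ## The torus of invertible elements of an algebra -/

namespace UnitTorus

section

variable (k : Type u) [Field k] (L : Type u) [CommRing L] [Algebra k L] [Module.Finite k L]

/-- The polynomial ring `k[X_i]` in the coordinates with respect to a basis of `L`;
this is the coordinate ring of `L` considered as an affine space. -/
abbrev Coord : Type u := MvPolynomial (Module.Free.ChooseBasisIndex k L) k

/-- The generic element `∑ X_i ⊗ b_i` of `L`, where `b_i` is a basis of `L`. -/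
def genericElement : Coord k L ⊗[k] L :=
  ∑ i, MvPolynomial.X i ⊗ₜ[k] Module.Free.chooseBasis k L i

/-- The norm of the generic element. -/
def normForm : Coord k L := Algebra.norm (Coord k L) (genericElement k L)

/-- The coordinate ring of `L^*`: the localization `k[X_i, 1 / N]`, where `N` is the norm of
the generic element. By `unitAlgebra_points` it represents the functor `R ↦ (R ⊗ L)ˣ`. -/
abbrev UnitAlgebra : Type u := Localization.Away (normForm k L)

instance : Algebra.FiniteType k (UnitAlgebra k L) :=
  Algebra.FiniteType.trans (S := Coord k L) inferInstance
    (IsLocalization.finiteType_of_monoid_fg (Submonoid.powers (normForm k L)) _)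

/-- The torus `L^*`, as a variety over `k`. -/
def unitTorus : GrothendieckVar.Variety k := GrothendieckVar.specVariety k (UnitAlgebra k L)

/-- The universal point of `L^*`. -/
def universalUnit : UnitAlgebra k L ⊗[k] L :=
  Algebra.TensorProduct.map (IsScalarTower.toAlgHom k (Coord k L) (UnitAlgebra k L))
    (AlgHom.id k L) (genericElement k L)

variable {k L}

theorem baseChange_repr_map {k : Type u} [Field k] {L : Type u} [CommRing L] [Algebra k L] {R : Type w} {S : Type v} [CommRing R] [Algebra k R] [CommRing S]
    [Algebra k S] {ι : Type*} (b : Module.Basis ι k L) (φ : S →ₐ[k] R) (y : S ⊗[k] L) (i : ι) :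
    (b.baseChange R).repr (Algebra.TensorProduct.map φ (AlgHom.id k L) y) i =
      φ ((b.baseChange S).repr y i) := by
  induction y with
  | zero => simp
  | tmul s l => simp [Module.Basis.baseChange_repr_tmul]
  | add x y hx hy => simp [hx, hy]

theorem map_norm_tensor {R : Type w} {S : Type v} [CommRing R] [Algebra k R] [CommRing S]
    [Algebra k S] (φ : S →ₐ[k] R) (y : S ⊗[k] L) :
    Algebra.norm R (Algebra.TensorProduct.map φ (AlgHom.id k L) y) = φ (Algebra.norm S y) := by
  classical
  let b := Module.Free.chooseBasis k L
  rw [Algebra.norm_eq_matrix_det (b.baseChange R), Algebra.norm_eq_matrix_det (b.baseChange S),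
    AlgHom.map_det]
  congr 1
  ext i j
  rw [AlgHom.mapMatrix_apply, Matrix.map_apply, Algebra.leftMulMatrix_eq_repr_mul,
    Algebra.leftMulMatrix_eq_repr_mul, ← baseChange_repr_map,
    map_mul (Algebra.TensorProduct.map φ (AlgHom.id k L))]
  simp

theorem exists_lift_away {k : Type u} [Field k] {A : Type v} [CommRing A] [Algebra k A]
    {R : Type w} [CommRing R] [Algebra k R] (f : A) (φ : A →ₐ[k] R) (hf : IsUnit (φ f)) :
    ∃ h : Localization.Away f →ₐ[k] R, ∀ x, h (algebraMap A (Localization.Away f) x) = φ x := by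
  have hf' : ∀ y : Submonoid.powers f, IsUnit (φ y) := by
    rintro ⟨_, m, rfl⟩
    rw [map_pow]
    exact hf.pow m
  exact ⟨IsLocalization.liftAlgHom (M := Submonoid.powers f) (f := φ) hf', fun x => by
    rw [IsLocalization.liftAlgHom_apply]
    exact IsLocalization.lift_eq _ x⟩

theorem isUnit_norm_tensor {R : Type w} [CommRing R] [Algebra k R] (y : R ⊗[k] L) :
    IsUnit (Algebra.norm R y) ↔ IsUnit y := by
  rw [Algebra.norm_apply, ← LinearMap.isUnit_iff_isUnit_det]
  constructor
  · intro h
    obtain ⟨z, hz⟩ := ((Module.End.isUnit_iff _).1 h).2 1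
    exact IsUnit.of_mul_eq_one z hz
  · intro h
    exact h.map (Algebra.lmul R (R ⊗[k] L))

variable (k L)

/-- The functor of points of `L^*`: for every commutative `k`-algebra `R`, pulling back the
universal point is a bijection from the `R`-points of `L^*` onto the units of `R ⊗ L`. -/
theorem unitAlgebra_points (R : Type w) [CommRing R] [Algebra k R] :
    Function.Injective (fun h : UnitAlgebra k L →ₐ[k] R =>
      Algebra.TensorProduct.map h (AlgHom.id k L) (universalUnit k L)) ∧
    Set.range (fun h : UnitAlgebra k L →ₐ[k] R =>
      Algebra.TensorProduct.map h (AlgHom.id k L) (universalUnit k L)) =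
        {u : R ⊗[k] L | IsUnit u} := by
  let b := Module.Free.chooseBasis k L
  let ι : Coord k L →ₐ[k] UnitAlgebra k L :=
    IsScalarTower.toAlgHom k (Coord k L) (UnitAlgebra k L)
  have hcomp : ∀ h : UnitAlgebra k L →ₐ[k] R,
      Algebra.TensorProduct.map h (AlgHom.id k L) (universalUnit k L) =
        Algebra.TensorProduct.map (h.comp ι) (AlgHom.id k L) (genericElement k L) := by
    intro h
    simp [universalUnit, genericElement, ι]
  have hrepr : ∀ (φ : Coord k L →ₐ[k] R) (i),
      (b.baseChange R).repr (Algebra.TensorProduct.map φ (AlgHom.id k L) (genericElement k L)) i =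
        φ (MvPolynomial.X i) := by
    intro φ i
    classical
    simp [genericElement, b, Module.Basis.baseChange_repr_tmul, Finsupp.single_apply, ite_smul]
  have hι : ι (normForm k L) = algebraMap _ (UnitAlgebra k L) (normForm k L) := rfl
  constructor
  · intro h h' hh
    simp only [hcomp] at hh
    have h1 : h.comp ι = h'.comp ι := by
      refine MvPolynomial.algHom_ext fun i => ?_
      rw [← hrepr, ← hrepr, hh]
    have h2 : (h : UnitAlgebra k L →+* R) = h' :=
      IsLocalization.ringHom_ext (Submonoid.powers (normForm k L))
        (RingHom.ext fun x => DFunLike.congr_fun h1 x)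
    exact AlgHom.ext fun x => DFunLike.congr_fun h2 x
  · ext u
    constructor
    · rintro ⟨h, rfl⟩
      change IsUnit (Algebra.TensorProduct.map h (AlgHom.id k L) (universalUnit k L))
      rw [hcomp, ← isUnit_norm_tensor, map_norm_tensor]
      exact (IsLocalization.Away.algebraMap_isUnit (S := UnitAlgebra k L) (normForm k L)).map h
    · intro hu
      let φ : Coord k L →ₐ[k] R := MvPolynomial.aeval fun i => (b.baseChange R).repr u i
      have hφ : Algebra.TensorProduct.map φ (AlgHom.id k L) (genericElement k L) = u := by
        refine (b.baseChange R).ext_elem fun i => ?_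
        rw [hrepr]
        simp [φ]
      have hN : IsUnit (φ (normForm k L)) := by
        rw [normForm, ← map_norm_tensor, hφ, isUnit_norm_tensor]
        exact hu
      obtain ⟨h, hh⟩ := exists_lift_away (normForm k L) φ hN
      refine ⟨h, ?_⟩
      change Algebra.TensorProduct.map h (AlgHom.id k L) (universalUnit k L) = u
      rw [hcomp, show h.comp ι = φ from AlgHom.ext hh, hφ]

end

end UnitTorus

/-! ## The Burnside ring of a topological group -/

namespace Burnside

/-- A finite set with a continuous action of the topological group `G`: the action on a finite
discrete set is continuous if and only if all stabilizers are open. -/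
structure FinGSet (G : Type v) [Group G] [TopologicalSpace G] where
  carrier : Type
  [finite : Finite carrier]
  [action : MulAction G carrier]
  isOpen_stabilizer : ∀ s : carrier, IsOpen (MulAction.stabilizer G s : Set G)

attribute [instance] FinGSet.finite FinGSet.action

namespace FinGSet

section

variable {G : Type v} [Group G] [TopologicalSpace G]

/-- Isomorphism of finite `G`-sets: existence of an equivariant bijection. -/
def Iso (S T : FinGSet G) : Prop :=
  ∃ e : S.carrier ≃ T.carrier, ∀ (g : G) (s : S.carrier), e (g • s) = g • e s

instance setoid (G : Type v) [Group G] [TopologicalSpace G] : Setoid (FinGSet G) where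
  r := Iso
  iseqv :=
    { refl := fun S => ⟨Equiv.refl _, fun _ _ => rfl⟩
      symm := fun ⟨e, he⟩ => ⟨e.symm, fun g s => by
        rw [Equiv.symm_apply_eq, he, Equiv.apply_symm_apply]⟩
      trans := fun ⟨e, he⟩ ⟨f, hf⟩ => ⟨e.trans f, fun g s => by
        simp [he, hf]⟩ }

/-- The disjoint union of two finite `G`-sets. -/
def sum (S T : FinGSet G) : FinGSet G where
  carrier := S.carrier ⊕ T.carrier
  action :=
    { smul := fun g => Sum.map (g • ·) (g • ·)
      one_smul := by
        rintro (s | t)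
        · exact congrArg Sum.inl (one_smul G s)
        · exact congrArg Sum.inr (one_smul G t)
      mul_smul := by
        rintro g h (s | t)
        · exact congrArg Sum.inl (mul_smul g h s)
        · exact congrArg Sum.inr (mul_smul g h t) }
  isOpen_stabilizer := by
    rintro (s | t)
    · convert S.isOpen_stabilizer s using 1
      ext g
      exact Sum.inl_injective.eq_iff
    · convert T.isOpen_stabilizer t using 1
      ext g
      exact Sum.inr_injective.eq_iff

/-- The product of two finite `G`-sets, with the diagonal action. -/
def prod (S T : FinGSet G) : FinGSet G where
  carrier := S.carrier × T.carrier
  isOpen_stabilizer := by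
    rintro ⟨s, t⟩
    convert (S.isOpen_stabilizer s).inter (T.isOpen_stabilizer t) using 1
    ext g
    exact Prod.ext_iff

/-- The one-point `G`-set. -/
def point (G : Type v) [Group G] [TopologicalSpace G] : FinGSet G where
  carrier := Unit
  action :=
    { smul := fun _ s => s
      one_smul := fun _ => rfl
      mul_smul := fun _ _ _ => rfl }
  isOpen_stabilizer := fun s => by
    convert isOpen_univ using 1
    ext g
    exact iff_of_true rfl trivial

/-- Restriction of the action along a continuous homomorphism `φ : H → G`:
`h • s = φ h • s`. -/
def restrict {H : Type w} [Group H] [TopologicalSpace H] (φ : H →ₜ* G) (S : FinGSet G) :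
    FinGSet H where
  carrier := S.carrier
  action := MulAction.compHom S.carrier φ.toMonoidHom
  isOpen_stabilizer := fun s => (S.isOpen_stabilizer s).preimage φ.continuous_toFun

theorem restrict_smul {H : Type w} [Group H] [TopologicalSpace H] (φ : H →ₜ* G) (S : FinGSet G)
    (h : H) (s : S.carrier) : (h • (show (S.restrict φ).carrier from s)) = φ h • s := rfl

/-- The set of families `(S_1, …, S_r)` of pairwise disjoint subsets of `S` with
`|S_j| = i_j`, where `α = (i_1, …, i_r)` is a tuple of positive integers with sum `i`. -/
abbrev DisjointFamily (S : FinGSet G) {i : ℕ} (α : Composition i) : Type :=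
  {T : Fin α.length → Set S.carrier //
    (∀ j, (T j).ncard = α.blocksFun j) ∧ Pairwise fun j l => Disjoint (T j) (T l)}

/-- The group acts by `g • (S_j)_j = (g • S_j)_j`. -/
instance (S : FinGSet G) {i : ℕ} (α : Composition i) : MulAction G (S.DisjointFamily α) where
  smul g T := ⟨fun j => g • T.1 j,
    fun j => (Set.ncard_image_of_injective _ (MulAction.injective g)).trans (T.2.1 j),
    fun _ _ h => Set.disjoint_image_of_injective (MulAction.injective g) (T.2.2 h)⟩
  one_smul T := Subtype.ext (funext fun j => one_smul G (T.1 j))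
  mul_smul g h T := Subtype.ext (funext fun j => mul_smul g h (T.1 j))

/-- The `G`-set `P_α(S)` of families `(S_1, …, S_r)` of pairwise disjoint subsets of `S` with
`|S_j| = i_j`, where `α = (i_1, …, i_r)`. -/
def disjointSubsets [IsTopologicalGroup G] (S : FinGSet G) {i : ℕ} (α : Composition i) :
    FinGSet G where
  carrier := S.DisjointFamily α
  isOpen_stabilizer := by
    intro T
    refine Subgroup.isOpen_mono (H₁ := ⨅ s : S.carrier, MulAction.stabilizer G s) ?_ ?_
    · intro g hg
      have hg' : ∀ s : S.carrier, g • s = s := fun s =>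
        MulAction.mem_stabilizer_iff.1 (Subgroup.mem_iInf.1 hg s)
      refine MulAction.mem_stabilizer_iff.2 (Subtype.ext (funext fun j => ?_))
      change g • T.1 j = T.1 j
      ext x
      simp [Set.mem_smul_set, hg']
    · rw [Subgroup.coe_iInf]
      exact isOpen_iInter_of_finite S.isOpen_stabilizer

end

end FinGSet

section

variable (G : Type v) [Group G] [TopologicalSpace G]

/-- Isomorphism classes of finite `G`-sets. -/
def IsoClass : Type (max 1 v) := Quotient (FinGSet.setoid G)

instance : CommMonoid (IsoClass G) where
  mul := Quotient.map₂ FinGSet.prod (by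
    rintro S S' ⟨e, he⟩ T T' ⟨f, hf⟩
    exact ⟨e.prodCongr f, fun g s => Prod.ext (he g s.1) (hf g s.2)⟩)
  one := Quotient.mk _ (FinGSet.point G)
  mul_assoc := by
    rintro ⟨S⟩ ⟨T⟩ ⟨U⟩
    exact Quotient.sound ⟨Equiv.prodAssoc _ _ _, fun _ _ => rfl⟩
  one_mul := by
    rintro ⟨S⟩
    exact Quotient.sound ⟨Equiv.punitProd _, fun _ _ => rfl⟩
  mul_one := by
    rintro ⟨S⟩
    exact Quotient.sound ⟨Equiv.prodPUnit _, fun _ _ => rfl⟩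
  mul_comm := by
    rintro ⟨S⟩ ⟨T⟩
    exact Quotient.sound ⟨Equiv.prodComm _ _, fun _ _ => rfl⟩

end

section

variable {G : Type v} [Group G] [TopologicalSpace G]

/-- The isomorphism class of a finite `G`-set. -/
def FinGSet.isoClass (S : FinGSet G) : IsoClass G := Quotient.mk _ S

/-- An invariant of finite `G`-sets as a function on isomorphism classes. -/
def IsoClass.lift {β : Type w} (f : FinGSet G → β)
    (hiso : ∀ S T : FinGSet G, S.Iso T → f S = f T) : IsoClass G → β :=
  Quotient.lift f hiso

theorem FinGSet.isoClass_prod (S T : FinGSet G) :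
    (S.prod T).isoClass = S.isoClass * T.isoClass := rfl

variable (G) in
/-- The relations `[S ⊔ T] - [S] - [T]`. -/
def sumRelations : Set (FreeAbelianGroup (IsoClass G)) :=
  {x | ∃ S T : FinGSet G, x = FreeAbelianGroup.of (S.sum T).isoClass
    - FreeAbelianGroup.of S.isoClass - FreeAbelianGroup.of T.isoClass}

theorem of_mul_sumRelations (a : IsoClass G) {x : FreeAbelianGroup (IsoClass G)}
    (hx : x ∈ sumRelations G) : FreeAbelianGroup.of a * x ∈ sumRelations G := by
  obtain ⟨S, T, rfl⟩ := hx
  obtain ⟨U, rfl⟩ : ∃ U : FinGSet G, U.isoClass = a := Quotient.exists_rep a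
  refine ⟨U.prod S, U.prod T, ?_⟩
  rw [mul_sub, mul_sub, FreeAbelianGroup.of_mul_of, FreeAbelianGroup.of_mul_of,
    FreeAbelianGroup.of_mul_of, ← FinGSet.isoClass_prod, ← FinGSet.isoClass_prod,
    ← FinGSet.isoClass_prod]
  congr 3
  refine Quotient.sound ⟨Equiv.prodSumDistrib _ _ _, ?_⟩
  rintro g ⟨u, s | t⟩ <;> rfl

variable (G) in
/-- The subgroup generated by the relations `[S ⊔ T] = [S] + [T]`, which is an ideal. -/
def sumIdeal : Ideal (FreeAbelianGroup (IsoClass G)) :=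
  { AddSubgroup.closure (sumRelations G) with
    smul_mem' := fun c x hx => by
      change c * x ∈ AddSubgroup.closure (sumRelations G)
      change x ∈ AddSubgroup.closure (sumRelations G) at hx
      induction c using FreeAbelianGroup.induction_on with
      | zero => simp
      | of a =>
        induction hx using AddSubgroup.closure_induction with
        | mem y hy => exact AddSubgroup.subset_closure (of_mul_sumRelations a hy)
        | zero => simp
        | add y z _ _ hy hz => rw [mul_add]; exact add_mem hy hz
        | neg y _ hy => rw [mul_neg]; exact neg_mem hy
      | neg a ha => rw [neg_mul]; exact neg_mem ha
      | add a b ha hb => rw [add_mul]; exact add_mem ha hb }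

variable (G) in
/-- The Burnside ring of `G`: the free abelian group on the isomorphism classes of finite
continuous `G`-sets modulo `[S ⊔ T] = [S] + [T]`, with multiplication `[S] * [T] = [S × T]`. -/
abbrev BurnsideRing : Type (max 1 v) := FreeAbelianGroup (IsoClass G) ⧸ sumIdeal G

/-- The class of a finite `G`-set in the Burnside ring. -/
def FinGSet.cls (S : FinGSet G) : BurnsideRing G :=
  Ideal.Quotient.mk _ (FreeAbelianGroup.of S.isoClass)

/-- An additive invariant of finite `G`-sets extends to the Burnside ring. -/
def lift {M : Type w} [AddCommGroup M] (f : FinGSet G → M)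
    (hiso : ∀ S T : FinGSet G, S.Iso T → f S = f T)
    (hsum : ∀ S T : FinGSet G, f (S.sum T) = f S + f T) : BurnsideRing G →+ M :=
  QuotientAddGroup.lift (Submodule.toAddSubgroup (sumIdeal G))
    (FreeAbelianGroup.lift (IsoClass.lift f hiso)) (by
      intro x hx
      change x ∈ AddSubgroup.closure (sumRelations G) at hx
      rw [AddMonoidHom.mem_ker]
      induction hx using AddSubgroup.closure_induction with
      | mem y hy =>
        obtain ⟨S, T, rfl⟩ := hy
        rw [map_sub, map_sub, FreeAbelianGroup.lift_apply_of, FreeAbelianGroup.lift_apply_of,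
          FreeAbelianGroup.lift_apply_of]
        change f (S.sum T) - f S - f T = 0
        rw [hsum, add_sub_cancel_left, sub_self]
      | zero => simp
      | add y z _ _ hy hz => rw [map_add, hy, hz, add_zero]
      | neg y _ hy => rw [map_neg, hy, neg_zero])

theorem lift_cls {M : Type w} [AddCommGroup M] (f : FinGSet G → M)
    (hiso : ∀ S T : FinGSet G, S.Iso T → f S = f T)
    (hsum : ∀ S T : FinGSet G, f (S.sum T) = f S + f T) (S : FinGSet G) :
    lift f hiso hsum S.cls = f S :=
  FreeAbelianGroup.lift_apply_of _ _

theorem cls_eq_of_iso {S T : FinGSet G} (h : S.Iso T) : S.cls = T.cls :=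
  congrArg (fun a => Ideal.Quotient.mk (sumIdeal G) (FreeAbelianGroup.of a)) (Quotient.sound h)

theorem cls_sum (S T : FinGSet G) : (S.sum T).cls = S.cls + T.cls := by
  have h : Ideal.Quotient.mk (sumIdeal G) (FreeAbelianGroup.of (S.sum T).isoClass
      - FreeAbelianGroup.of S.isoClass - FreeAbelianGroup.of T.isoClass) = 0 :=
    Ideal.Quotient.eq_zero_iff_mem.2 (AddSubgroup.subset_closure ⟨S, T, rfl⟩)
  rw [map_sub, map_sub, sub_sub, sub_eq_zero] at h
  exact h

theorem cls_prod (S T : FinGSet G) : (S.prod T).cls = S.cls * T.cls := by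
  unfold FinGSet.cls
  rw [FinGSet.isoClass_prod, ← FreeAbelianGroup.of_mul_of, map_mul]

theorem cls_point : (FinGSet.point G).cls = 1 := rfl

/-- The multiplicative map `[S] ↦ [S]`, where `S` is viewed as an `H`-set via `φ : H → G`. -/
def isoClassRes {H : Type w} [Group H] [TopologicalSpace H] (φ : H →ₜ* G) :
    IsoClass G →* BurnsideRing H where
  toFun := IsoClass.lift (fun S : FinGSet G => (S.restrict φ).cls)
    (fun _ _ ⟨e, he⟩ => cls_eq_of_iso ⟨e, fun h s => he (φ h) s⟩)
  map_one' := cls_eq_of_iso ⟨Equiv.refl _, fun _ _ => rfl⟩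
  map_mul' := by
    rintro ⟨S⟩ ⟨T⟩
    exact (cls_eq_of_iso ⟨Equiv.refl _, fun _ _ => rfl⟩).trans
      (cls_prod (S.restrict φ) (T.restrict φ))

/-- The restriction homomorphism `B(G) → B(H)` along a continuous homomorphism `φ : H → G`. -/
def res {H : Type w} [Group H] [TopologicalSpace H] (φ : H →ₜ* G) :
    BurnsideRing G →+* BurnsideRing H :=
  Ideal.Quotient.lift (sumIdeal G)
    (FreeAbelianGroup.liftMonoid (isoClassRes φ))
    (by
      intro x hx
      change x ∈ AddSubgroup.closure (sumRelations G) at hx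
      induction hx using AddSubgroup.closure_induction with
      | mem y hy =>
        obtain ⟨S, T, rfl⟩ := hy
        rw [map_sub, map_sub, FreeAbelianGroup.liftMonoid_coe, FreeAbelianGroup.lift_apply_of,
          FreeAbelianGroup.lift_apply_of, FreeAbelianGroup.lift_apply_of]
        change ((S.sum T).restrict φ).cls - (S.restrict φ).cls - (T.restrict φ).cls = 0
        have h : ((S.sum T).restrict φ).cls = ((S.restrict φ).sum (T.restrict φ)).cls :=
          cls_eq_of_iso ⟨Equiv.refl _, by rintro g (s | t) <;> rfl⟩
        rw [h, cls_sum, add_sub_cancel_left, sub_self]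
      | zero => simp
      | add y z _ _ hy hz => rw [map_add, hy, hz, add_zero]
      | neg y _ hy => rw [map_neg, hy, neg_zero])

theorem res_cls {H : Type w} [Group H] [TopologicalSpace H] (φ : H →ₜ* G) (S : FinGSet G) :
    res φ S.cls = (S.restrict φ).cls :=
  FreeAbelianGroup.lift_apply_of (isoClassRes φ) S.isoClass

end

/-- The symmetric group `S_n`, a finite group, carries the discrete topology. -/
instance permTopology (n : ℕ) : TopologicalSpace (Equiv.Perm (Fin n)) := ⊥

instance (n : ℕ) : DiscreteTopology (Equiv.Perm (Fin n)) := ⟨rfl⟩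

/-- The `S_n`-set `{1, …, n}`. -/
def standardSet (n : ℕ) : FinGSet (Equiv.Perm (Fin n)) where
  carrier := Fin n
  isOpen_stabilizer := fun _ => isOpen_discrete _

/-- The element `ρ_i^{(n)} = ∑ (-1)^t [P_{i_1,…,i_t}({1, …, n})]` of the Burnside ring of `S_n`;
the sum is over all tuples `(i_1, …, i_t)` of positive integers with sum `i`. -/
def rho (n i : ℕ) : BurnsideRing (Equiv.Perm (Fin n)) :=
  ∑ α : Composition i, (-1) ^ α.length * ((standardSet n).disjointSubsets α).cls

end Burnside

/-! ## Galois theory -/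

namespace ArtinClasses

open Burnside GrothendieckVar

section

variable {k : Type u} [Field k] {Ω : Type u} [Field Ω] [Algebra k Ω]

/-- The `k`-algebra `Hom_G(S, Ω)` of equivariant maps from the `G`-set `S` to `Ω`, where `G` is the
Galois group of `Ω / k`, with pointwise operations. -/
def equivariantMaps (S : FinGSet Gal(Ω/k)) : Subalgebra k (S.carrier → Ω) where
  carrier := {f | ∀ (g : Gal(Ω/k)) (s : S.carrier), f (g • s) = g (f s)}
  mul_mem' := fun {a b} ha hb g s => by simp [ha g s, hb g s]
  add_mem' := fun {a b} ha hb g s => by simp [ha g s, hb g s]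
  algebraMap_mem' := fun r g s => by simp

instance [IsGalois k Ω] (S : FinGSet Gal(Ω/k)) : Module.Finite k (equivariantMaps S) := by
  have h : ∀ s : S.carrier, ∃ E : IntermediateField k Ω, FiniteDimensional k E ∧
      (E.fixingSubgroup : Set Gal(Ω/k)) ⊆ MulAction.stabilizer Gal(Ω/k) s := fun s =>
    (krullTopology_mem_nhds_one_iff k Ω _).1
      ((S.isOpen_stabilizer s).mem_nhds (one_mem (MulAction.stabilizer Gal(Ω/k) s)))
  choose E hE hES using h
  have hmem : ∀ (f : equivariantMaps S) (s : S.carrier), f.1 s ∈ E s := fun f s => by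
    rw [← InfiniteGalois.fixedField_fixingSubgroup (E s), IntermediateField.mem_fixedField_iff]
    intro g hg
    rw [← f.2 g s, MulAction.mem_stabilizer_iff.1 (hES s hg)]
  let ι : equivariantMaps S →ₗ[k] (∀ s : S.carrier, E s) :=
    { toFun := fun f s => ⟨f.1 s, hmem f s⟩
      map_add' := fun _ _ => rfl
      map_smul' := fun _ _ => rfl }
  refine Module.Finite.of_injective ι fun f g hfg => Subtype.ext (funext fun s => ?_)
  exact congrArg Subtype.val (congrFun hfg s)

/-- An isomorphism of `G`-sets induces an isomorphism of the corresponding algebras. -/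
def equivariantMapsCongr {S T : FinGSet Gal(Ω/k)} (e : S.carrier ≃ T.carrier)
    (he : ∀ (g : Gal(Ω/k)) (s : S.carrier), e (g • s) = g • e s) :
    equivariantMaps S ≃ₐ[k] equivariantMaps T where
  toFun f := ⟨fun t => f.1 (e.symm t), fun g t =>
    (congrArg f.1 (show e.symm (g • t) = g • e.symm t by rw [Equiv.symm_apply_eq, he,
      Equiv.apply_symm_apply])).trans (f.2 g (e.symm t))⟩
  invFun f := ⟨fun s => f.1 (e s), fun g s =>
    (congrArg f.1 (he g s)).trans (f.2 g (e s))⟩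
  left_inv f := Subtype.ext (funext fun s => congrArg f.1 (e.symm_apply_apply s))
  right_inv f := Subtype.ext (funext fun t => congrArg f.1 (e.apply_symm_apply t))
  map_mul' _ _ := rfl
  map_add' _ _ := rfl
  commutes' _ := rfl

/-- A disjoint union of `G`-sets corresponds to the product of the algebras. -/
def equivariantMapsSum (S T : FinGSet Gal(Ω/k)) :
    equivariantMaps (S.sum T) ≃ₐ[k] equivariantMaps S × equivariantMaps T where
  toFun f := (⟨fun s => f.1 (Sum.inl s), fun g s => f.2 g (Sum.inl s)⟩,
    ⟨fun t => f.1 (Sum.inr t), fun g t => f.2 g (Sum.inr t)⟩)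
  invFun f := ⟨Sum.elim f.1.1 f.2.1, by
    rintro g (s | t)
    · exact f.1.2 g s
    · exact f.2.2 g t⟩
  left_inv f := Subtype.ext (funext fun s => by cases s <;> rfl)
  right_inv _ := rfl
  map_mul' _ _ := rfl
  map_add' _ _ := rfl
  commutes' _ := rfl

variable (k Ω) in
/-- The homomorphism `Art_k : B(G) → K₀(Var_k)`, where `Ω` is a separable closure of `k` and `G` its
Galois group: it sends the class of a `G`-set `S` to the class of the spectrum of the corresponding
separable `k`-algebra `Hom_G(S, Ω)`. This determines it as an additive map, so it is constructed
as a homomorphism of the additive groups. -/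
def art [IsSepClosure k Ω] : BurnsideRing Gal(Ω/k) →+ K0Var k :=
  Burnside.lift (fun S => specClass k (equivariantMaps S))
    (fun _ _ ⟨e, he⟩ => specClass_congr (equivariantMapsCongr e he))
    (fun S T => (specClass_congr (equivariantMapsSum S T)).trans specClass_prod)

theorem art_cls [IsSepClosure k Ω] (S : FinGSet Gal(Ω/k)) :
    art k Ω S.cls = specClass k (equivariantMaps S) :=
  Burnside.lift_cls _ _ _ S

/-- The action of the Galois group of `Ω / k` on the set of `k`-algebra homomorphisms `L → Ω`,
by composition. -/
instance galoisAction (L : Type w) [CommRing L] [Algebra k L] :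
    MulAction Gal(Ω/k) (L →ₐ[k] Ω) where
  smul g f := g.toAlgHom.comp f
  one_smul _ := rfl
  mul_smul _ _ _ := rfl

theorem galoisAction_apply {L : Type w} [CommRing L] [Algebra k L] (g : Gal(Ω/k)) (f : L →ₐ[k] Ω)
    (x : L) : (g • f) x = g (f x) := rfl

/-- The homomorphism `G → S_n` describing the action of the Galois group `G` on `Hom_k(L, Ω)`,
after numbering the elements of this set by `1, …, n`. -/
def galoisToPerm [Algebra.IsAlgebraic k Ω] {L : Type w} [CommRing L] [Algebra k L]
    [Module.Finite k L] {n : ℕ} (e : (L →ₐ[k] Ω) ≃ Fin n) :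
    Gal(Ω/k) →ₜ* Equiv.Perm (Fin n) where
  toMonoidHom := (Equiv.permCongrHom e).toMonoidHom.comp
    (MulAction.toPermHom Gal(Ω/k) (L →ₐ[k] Ω))
  continuous_toFun := by
    refine continuous_of_continuousAt_one ((Equiv.permCongrHom e).toMonoidHom.comp
      (MulAction.toPermHom Gal(Ω/k) (L →ₐ[k] Ω))) ?_
    rw [ContinuousAt, map_one, nhds_discrete (Equiv.Perm (Fin n)), Filter.tendsto_pure]
    have hfin : Finite (L →ₐ[k] Ω) := Finite.of_equiv _ e.symm
    let b := Module.finBasis k L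
    have h : ∀ (f : L →ₐ[k] Ω) (i : Fin (Module.finrank k L)),
        ∀ᶠ g : Gal(Ω/k) in nhds 1, g • f (b i) = f (b i) := fun f i =>
      (stabilizer_isOpen_of_isIntegral (K := k) (f (b i))).mem_nhds
        (one_mem (MulAction.stabilizer Gal(Ω/k) (f (b i))))
    filter_upwards [Filter.eventually_all.2 fun f => Filter.eventually_all.2 (h f)] with g hg
    have hg' : MulAction.toPermHom Gal(Ω/k) (L →ₐ[k] Ω) g = 1 := by
      ext f : 1
      refine AlgHom.toLinearMap_injective (b.ext fun i => ?_)
      exact hg f i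
    rw [MonoidHom.comp_apply, hg', map_one]

theorem galoisToPerm_apply [Algebra.IsAlgebraic k Ω] {L : Type w} [CommRing L] [Algebra k L]
    [Module.Finite k L] {n : ℕ} (e : (L →ₐ[k] Ω) ≃ Fin n) (g : Gal(Ω/k)) (f : L →ₐ[k] Ω) :
    galoisToPerm e g (e f) = e (g • f) :=
  congrArg (fun x => e (g • x)) (e.symm_apply_apply f)

end

end ArtinClasses

end

/-! Write `G` for the Galois group and identify the embeddings `L → Ω` with `1, …, n`. Over `Ω` the
affine space of `L` is `𝔸^n`, with one coordinate `x_s` for each embedding `s`; the group `G`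
permutes the coordinates, and `L^*` is the locus where no coordinate vanishes. The affine space is
stratified by the number `i` of vanishing coordinates. The stratum of index `i` is not a single
torus: it lies over the étale scheme of `i`-element subsets `Z` of `{1, …, n}`, and the fibre over
`Z` is the torus of points whose vanishing coordinates are exactly those in `Z`.

To iterate this, the statement is generalized to a `SubsetFamily`: a finite `G`-set `B` and an
equivariant family of `m`-element subsets `D b` of `{1, …, n}`. It defines a bundle of coordinate
subspaces `𝔸^{D b}` over `B`, with a bundle of tori inside. The coordinate ring `coordRing` of the
bundle consists of Galois-equivariant families of polynomials, so that no descent theory is needed.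
The facts used are the following.

* The bundle is trivial (`Frame.coordRingEquiv`, `nonempty_frame`): by the linear independence of
  the embeddings, `m` suitable elements of `L` provide invariant coordinates. Hence its class is
  `art [B] * 𝕃 ^ m`.
* The points with `i` vanishing coordinates form the bundle of tori of `zeroFamily i`, whose base
  consists of the pairs `(b, Z)` with `Z ⊆ D b`, `|Z| = i`
  (`specClass_torusAlgebra_zeroFamily`). The locus is cut out by elementary symmetric functions, up
  to nilpotents, which do not affect the class. That its reduction is the bundle of tori is shown by
  extending functions explicitly (`exists_restrictZero_eq`) and by describing the prime ideals of
  `coordRing` through points over `Ω` (`exists_ringHom_of_isPrime`), which uses integrality.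
* Therefore `art [B] * 𝕃 ^ m` is the sum of the classes of the tori of `zeroFamily i` for
  `0 ≤ i ≤ m` (`sum_specClass_torusAlgebra`), and the term for `i = 0` is the class wanted. Solving
  for it and iterating gives an alternating sum over tuples of disjoint subsets
  (`torusClass_eq_sum`), in which the coefficients satisfy the recursion obtained by splitting off
  the first block of a composition (`coeff_succ`).

For the full family over a point, the torus is `L^*`, because the norm is the product of the
conjugates (`specClass_unitAlgebra`), and the coefficients are the images of the `ρ_i`
(`art_res_rho`). -/

noncomputable section

/-! ### Classes of affine schemes in the Grothendieck ring -/

namespace GrothendieckVar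

variable {k : Type u} [Field k]

theorem K0Var.mk_tensor (X Y : Variety k) : K0Var.mk (X ⊗ Y) = K0Var.mk X * K0Var.mk Y := by
  unfold K0Var.mk
  rw [← map_mul, FreeAbelianGroup.of_mul_of, Skeleton.toSkeleton_tensorObj]

theorem specClass_tensor (A B : Type u) [CommRing A] [Algebra k A]
    [Algebra.FiniteType k A] [CommRing B] [Algebra k B] [Algebra.FiniteType k B]
    [Algebra.FiniteType k (A ⊗[k] B)] :
    specClass k (A ⊗[k] B) = specClass k A * specClass k B := by
  unfold specClass
  rw [← K0Var.mk_tensor]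
  refine K0Var.mk_eq_of_iso
    ((finiteTypeOver k).isoMk (Over.isoMk (pullbackSpecIso k A B).symm ?_))
  change (pullbackSpecIso k A B).inv ≫ Limits.pullback.fst _ _ ≫
    Spec.map (CommRingCat.ofHom (algebraMap k A)) = Spec.map _
  rw [pullbackSpecIso_inv_fst_assoc, ← Spec.map_comp]
  rfl

theorem specClass_polynomial (A : Type u) [CommRing A] [Algebra k A] [Algebra.FiniteType k A] :
    specClass k (Polynomial A) = specClass k A * lefschetz k := by
  have : Algebra.FiniteType k (A ⊗[k] Polynomial k) :=
    Algebra.FiniteType.equiv (inferInstance : Algebra.FiniteType k (Polynomial A))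
      (polyEquivTensor k A)
  rw [lefschetz, ← specClass_tensor]
  exact specClass_congr (polyEquivTensor k A)

theorem specClass_mvPolynomial (A : Type u) [CommRing A] [Algebra k A] [Algebra.FiniteType k A]
    (m : ℕ) : specClass k (MvPolynomial (Fin m) A) = specClass k A * lefschetz k ^ m := by
  induction m with
  | zero =>
    rw [pow_zero, mul_one]
    exact specClass_congr ((MvPolynomial.isEmptyAlgEquiv A (Fin 0)).restrictScalars k)
  | succ m ih =>
    rw [pow_succ, ← mul_assoc, ← ih, ← specClass_polynomial]
    exact specClass_congr ((MvPolynomial.finSuccEquiv A m).restrictScalars k)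

theorem specClass_of_subsingleton (A : Type u) [CommRing A] [Algebra k A]
    [Algebra.FiniteType k A] [Subsingleton A] : specClass k A = 0 := by
  have e : A ≃ₐ[k] A × A := AlgEquiv.ofBijective ((AlgHom.id k A).prod (AlgHom.id k A))
    ⟨fun _ _ _ => Subsingleton.elim _ _, fun _ => ⟨0, Subsingleton.elim _ _⟩⟩
  simpa using (specClass_congr e).trans specClass_prod

/-- The scissor relation for an affine variety: a principal open subset, and a closed subscheme
supported on its complement. The closed subscheme may be defined by any ideal with the right
zero locus. -/
theorem specClass_eq_away_add {A B C : Type u} [CommRing A] [Algebra k A]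
    [Algebra.FiniteType k A] [CommRing B] [Algebra k B] [Algebra.FiniteType k B] [CommRing C]
    [Algebra k C] [Algebra.FiniteType k C] [Algebra A B] [IsScalarTower k A B] (f : A)
    [IsLocalization.Away f B] (α : A →ₐ[k] C) (hα : Function.Surjective α)
    (h : ∀ p : Ideal A, p.IsPrime → (f ∈ p ↔ RingHom.ker α ≤ p)) :
    specClass k A = specClass k B + specClass k C := by
  refine K0Var.scissor (specVarietyMap α) (specVarietyMap (IsScalarTower.toAlgHom k A B)) ?_ ?_ ?_
  · exact IsClosedImmersion.spec_of_surjective (CommRingCat.ofHom α.toRingHom) hα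
  · exact IsOpenImmersion.of_isLocalization f
  · change Set.range (PrimeSpectrum.comap (algebraMap A B)) =
      (Set.range (PrimeSpectrum.comap α.toRingHom))ᶜ
    rw [PrimeSpectrum.localization_away_comap_range B f,
      range_comap_of_surjective _ _ hα]
    ext p
    exact not_congr (h p.asIdeal p.2)

theorem specClass_eq_of_ker_le_nilradical {A C : Type u} [CommRing A] [Algebra k A]
    [Algebra.FiniteType k A] [CommRing C] [Algebra k C] [Algebra.FiniteType k C]
    (α : A →ₐ[k] C) (hα : Function.Surjective α) (h : RingHom.ker α ≤ nilradical A) :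
    specClass k A = specClass k C := by
  have : Algebra.FiniteType k (Localization.Away (0 : A)) :=
    Algebra.FiniteType.trans (S := A) inferInstance
      (IsLocalization.finiteType_of_monoid_fg (Submonoid.powers (0 : A)) _)
  have : Subsingleton (Localization.Away (0 : A)) :=
    IsLocalization.subsingleton (M := Submonoid.powers (0 : A)) (Submonoid.mem_powers 0)
  rw [specClass_eq_away_add (B := Localization.Away (0 : A)) 0 α hα, specClass_of_subsingleton,
    zero_add]
  intro p hp
  simpa using h.trans (nilradical_le_prime p)

instance finiteType_away {k : Type u} [Field k] {A : Type u} [CommRing A] [Algebra k A]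
    [Algebra.FiniteType k A] (f : A) : Algebra.FiniteType k (Localization.Away f) :=
  Algebra.FiniteType.trans (S := A) inferInstance
    (IsLocalization.finiteType_of_monoid_fg (Submonoid.powers f) _)

/-- A homomorphism `β : A → C` which becomes surjective with nilpotent kernel after inverting `f`
identifies the classes of the corresponding principal open subsets. -/
theorem specClass_away_eq {k : Type u} [Field k] {A C : Type u} [CommRing A] [Algebra k A]
    [Algebra.FiniteType k A] [CommRing C] [Algebra k C] [Algebra.FiniteType k C] (β : A →ₐ[k] C)
    (f : A) (hs : ∀ c, ∃ a, β a = c * β f) (hk : ∀ a, β a = 0 → IsNilpotent (f * a)) :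
    specClass k (Localization.Away f) = specClass k (Localization.Away (β f)) := by
  obtain ⟨γ, hγ⟩ : ∃ γ : Localization.Away f →ₐ[k] Localization.Away (β f),
      ∀ a, γ (algebraMap A _ a) = algebraMap C _ (β a) :=
    UnitTorus.exists_lift_away f
      ((IsScalarTower.toAlgHom k C (Localization.Away (β f))).comp β)
      (IsLocalization.Away.algebraMap_isUnit (β f))
  have hu : IsUnit (algebraMap C (Localization.Away (β f)) (β f)) :=
    IsLocalization.Away.algebraMap_isUnit (β f)
  have hu' : IsUnit (algebraMap A (Localization.Away f) f) :=
    IsLocalization.Away.algebraMap_isUnit f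
  refine specClass_eq_of_ker_le_nilradical γ (fun z => ?_) fun z hz => ?_
  · obtain ⟨N, c, hc⟩ := IsLocalization.Away.surj (β f) z
    obtain ⟨a, ha⟩ := hs c
    refine ⟨algebraMap A _ a * (hu'.unit⁻¹ ^ (N + 1) : (Localization.Away f)ˣ), ?_⟩
    refine (hu.pow (N + 1)).mul_right_cancel ?_
    have h1 : (algebraMap C (Localization.Away (β f)) (β f)) ^ (N + 1) =
        γ ((algebraMap A (Localization.Away f) f) ^ (N + 1)) := by rw [map_pow, hγ]
    have h3 : z * algebraMap C (Localization.Away (β f)) (β f) ^ (N + 1) =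
        γ (algebraMap A _ a) := by
      rw [pow_succ, ← mul_assoc z, hc, ← map_mul, ← ha, hγ]
    rw [h3, h1, ← map_mul, mul_assoc]
    have h2 : ((hu'.unit⁻¹ ^ (N + 1) : (Localization.Away f)ˣ) : Localization.Away f) *
        algebraMap A (Localization.Away f) f ^ (N + 1) = 1 := by
      rw [Units.val_pow_eq_pow_val, ← mul_pow, IsUnit.val_inv_mul, one_pow]
    rw [h2, mul_one]
  · rw [RingHom.mem_ker] at hz
    change γ z = 0 at hz
    obtain ⟨N, a, ha⟩ := IsLocalization.Away.surj f z
    have h1 : algebraMap C (Localization.Away (β f)) (β a) = 0 := by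
      rw [← hγ, ← ha, map_mul, hz, zero_mul]
    obtain ⟨⟨_, M, rfl⟩, hM⟩ := (IsLocalization.map_eq_zero_iff (Submonoid.powers (β f)) _ _).1 h1
    have h2 : IsNilpotent (f * (f ^ M * a)) := hk _ (by rw [map_mul, map_pow]; exact hM)
    have h3 : algebraMap A (Localization.Away f) (f * (f ^ M * a)) =
        z * algebraMap A (Localization.Away f) f ^ (N + M + 1) := by
      rw [map_mul, map_mul, map_pow, ← ha]
      ring
    have h4 := h2.map (algebraMap A (Localization.Away f))
    rw [h3] at h4
    rw [mem_nilradical]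
    obtain ⟨K, hK⟩ := h4
    rw [mul_pow] at hK
    exact ⟨K, ((hu'.pow (N + M + 1)).pow K).mul_left_eq_zero.1 hK⟩

end GrothendieckVar

/-! ### Primes under integral extensions, and sums over compositions -/

/-- Let `ι b` be ring homomorphisms, not preserving `1`, whose values at `1` sum to `1` and whose
values are integral over `R`. Then every prime ideal of `R` is detected by one of the `ι b`. -/
theorem exists_ringHom_of_isIntegral {R P : Type*} {M : Type u} [CommRing R] [CommRing M]
    [CommRing P] [Algebra R M] (hinj : Function.Injective (algebraMap R M)) {B : Type*} [Fintype B]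
    (ι : B → P →ₙ+* M) (hι : ∀ b x, IsIntegral R (ι b x)) (hsum : ∑ b, ι b 1 = 1) (p : Ideal R)
    [p.IsPrime] : ∃ (b : B) (κ : Type u) (_ : CommRing κ) (_ : IsDomain κ) (φ : P →+* κ),
      ∀ (a : R) (x : P),
        ι b x = algebraMap R M a * ι b 1 → (a ∈ p ↔ φ x = 0) := by
  obtain ⟨q, -, hq, hqp⟩ := Ideal.exists_ideal_over_prime_of_isIntegral p
    (⊥ : Ideal (integralClosure R M)) (by
      intro x hx
      have hx' : algebraMap R M x = 0 :=
        congrArg Subtype.val (show algebraMap R (integralClosure R M) x = 0 from hx)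
      rw [hinj (hx'.trans (map_zero _).symm)]
      exact p.zero_mem)
  let ι' : B → P →ₙ+* integralClosure R M := fun b =>
    { toFun := fun x => ⟨ι b x, hι b x⟩
      map_mul' := fun x y => Subtype.ext (map_mul (ι b) x y)
      map_zero' := Subtype.ext (map_zero (ι b))
      map_add' := fun x y => Subtype.ext (map_add (ι b) x y) }
  have hsum' : ∑ b, ι' b 1 = 1 := Subtype.ext (by
    rw [AddSubmonoidClass.coe_finsetSum]
    exact hsum)
  obtain ⟨b, hb⟩ : ∃ b, ι' b 1 ∉ q := by
    by_contra! h
    exact hq.ne_top ((Ideal.eq_top_iff_one q).2 (hsum' ▸ Ideal.sum_mem _ fun b _ => h b))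
  let φ : P →+* integralClosure R M ⧸ q :=
    { toFun := fun x => Ideal.Quotient.mk q (ι' b x)
      map_one' := by
        have h1 : Ideal.Quotient.mk q (ι' b 1) * Ideal.Quotient.mk q (ι' b 1) =
          Ideal.Quotient.mk q (ι' b 1) := by rw [← map_mul, ← map_mul, one_mul]
        exact mul_right_cancel₀ (mt Ideal.Quotient.eq_zero_iff_mem.1 hb) (h1.trans (one_mul _).symm)
      map_mul' := fun x y => by rw [map_mul, map_mul]
      map_zero' := by rw [map_zero, map_zero]
      map_add' := fun x y => by rw [map_add, map_add] }
  refine ⟨b, integralClosure R M ⧸ q, inferInstance, inferInstance, φ, fun a x hx => ?_⟩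
  have ha : ι' b x = algebraMap R (integralClosure R M) a * ι' b 1 := Subtype.ext hx
  change _ ↔ Ideal.Quotient.mk q (ι' b x) = 0
  rw [Ideal.Quotient.eq_zero_iff_mem, ha, hq.mul_mem_right_iff hb, ← hqp]
  rfl

/-- Splitting off the first block `i + 1` of a composition of `l + 1`. -/
theorem sum_composition_succ {M : Type*} [AddCommMonoid M] (F : List ℕ → M) (l : ℕ) :
    ∑ α : Composition (l + 1), F α.blocks =
      ∑ i ∈ Finset.range (l + 1), ∑ β : Composition (l - i), F ((i + 1) :: β.blocks) := by
  rw [Finset.sum_range, ← Fintype.sum_sigma']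
  symm
  let f : (Σ i : Fin (l + 1), Composition (l - i)) → Composition (l + 1) := fun x =>
    { blocks := (x.1.1 + 1) :: x.2.blocks
      blocks_pos := by
        intro i hi
        rcases List.mem_cons.1 hi with rfl | hi
        · exact Nat.succ_pos _
        · exact x.2.blocks_pos hi
      blocks_sum := by
        rw [List.sum_cons, x.2.blocks_sum]
        have := x.1.2
        omega }
  refine Fintype.sum_bijective f ⟨?_, fun α => ?_⟩ _ _ fun x => rfl
  · rintro ⟨i, β⟩ ⟨i', β'⟩ h
    obtain ⟨h1, h2⟩ := List.cons.inj (congrArg Composition.blocks h)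
    obtain rfl : i = i' := Fin.ext (Nat.succ_injective h1)
    have hβ : β = β' := Composition.ext h2
    rw [hβ]
  · obtain ⟨a, t, hat⟩ : ∃ a t, α.blocks = a :: t := List.exists_cons_of_ne_nil fun h => by
      have := α.blocks_sum
      simp [h] at this
    have ha : 0 < a := α.blocks_pos (hat ▸ List.mem_cons_self)
    have hsum : a + t.sum = l + 1 := by rw [← List.sum_cons, ← hat, α.blocks_sum]
    refine ⟨⟨⟨a - 1, by omega⟩, ⟨t, fun hi => α.blocks_pos (hat ▸ List.mem_cons_of_mem _ hi),
      by simp only; omega⟩⟩, Composition.ext ?_⟩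
    change (a - 1 + 1) :: t = α.blocks
    rw [hat, Nat.sub_add_cancel ha]

namespace ArtinClasses

open Burnside GrothendieckVar UnitTorus

/-! ### Families of coordinate subsets and their coordinate rings -/

section

variable {k : Type u} [Field k] {Ω : Type u} [Field Ω] [Algebra k Ω] [IsSepClosure k Ω]
  {L : Type u} [CommRing L] [Algebra k L] [Module.Finite k L] {n : ℕ}

/-- The `Ω`-algebra endomorphism setting the variables outside `D` to zero. -/
def killOutside (Ω : Type u) [Field Ω] {n : ℕ} (D : Finset (Fin n)) :
    MvPolynomial (Fin n) Ω →ₐ[Ω] MvPolynomial (Fin n) Ω :=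
  MvPolynomial.aeval fun s => if s ∈ D then MvPolynomial.X s else 0

theorem killOutside_X (D : Finset (Fin n)) (s : Fin n) :
    killOutside Ω D (MvPolynomial.X s) = if s ∈ D then MvPolynomial.X s else 0 :=
  MvPolynomial.aeval_X _ s

theorem killOutside_C (D : Finset (Fin n)) (c : Ω) :
    killOutside Ω D (MvPolynomial.C c) = MvPolynomial.C c :=
  (killOutside Ω D).commutes c

theorem killOutside_killOutside (D D' : Finset (Fin n)) (p : MvPolynomial (Fin n) Ω) :
    killOutside Ω D (killOutside Ω D' p) = killOutside Ω (D ∩ D') p := by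
  have : (killOutside Ω D).comp (killOutside Ω D') = killOutside Ω (D ∩ D') := by
    refine MvPolynomial.algHom_ext fun s => ?_
    rw [AlgHom.comp_apply, killOutside_X, killOutside_X]
    by_cases h : s ∈ D' <;> by_cases h' : s ∈ D <;> simp [h, h', killOutside_X]
  exact DFunLike.congr_fun this p

variable (e : (L →ₐ[k] Ω) ≃ Fin n)

theorem symm_galoisToPerm (g : Gal(Ω/k)) (s : Fin n) (x : L) :
    e.symm (galoisToPerm e g s) x = g (e.symm s x) := by
  have h := galoisToPerm_apply e g (e.symm s)
  rw [e.apply_symm_apply] at h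
  rw [h, e.symm_apply_apply, galoisAction_apply]

/-- The semilinear action of the Galois group on the polynomial ring `Ω[x_s]`, whose variables are
indexed by the (numbered) embeddings `s` of `L`: it acts on the coefficients and permutes the
variables. -/
def semilinearAct (g : Gal(Ω/k)) : MvPolynomial (Fin n) Ω →+* MvPolynomial (Fin n) Ω :=
  MvPolynomial.eval₂Hom (MvPolynomial.C.comp (g : Ω →+* Ω))
    fun s => MvPolynomial.X (galoisToPerm e g s)

theorem semilinearAct_C (g : Gal(Ω/k)) (c : Ω) :
    semilinearAct e g (MvPolynomial.C c) = MvPolynomial.C (g c) :=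
  MvPolynomial.eval₂Hom_C _ _ c

theorem semilinearAct_X (g : Gal(Ω/k)) (s : Fin n) :
    semilinearAct e g (MvPolynomial.X s) = MvPolynomial.X (galoisToPerm e g s) :=
  MvPolynomial.eval₂Hom_X' _ _ s

theorem killOutside_semilinearAct (g : Gal(Ω/k)) {D D' : Finset (Fin n)}
    (h : ∀ s, galoisToPerm e g s ∈ D' ↔ s ∈ D) (p : MvPolynomial (Fin n) Ω) :
    killOutside Ω D' (semilinearAct e g p) = semilinearAct e g (killOutside Ω D p) := by
  have : ((killOutside Ω D').toRingHom.comp (semilinearAct e g)) =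
      (semilinearAct e g).comp (killOutside Ω D).toRingHom := by
    refine MvPolynomial.ringHom_ext (fun c => ?_) fun s => ?_
    · simp [semilinearAct_C]
    · simp only [AlgHom.toRingHom_eq_coe, RingHom.comp_apply, RingHom.coe_coe, semilinearAct_X,
        killOutside_X, h s]
      split_ifs <;> simp [semilinearAct_X]
  exact DFunLike.congr_fun this p

/-- A finite `G`-set `B` together with an equivariant family of `m`-element subsets `D b` of the
set of embeddings of `L`. Such a family stands for the affine bundle over the étale scheme `B`
whose fibre over `b` is the coordinate subspace `𝔸^{D b}` of `𝔸^n`. -/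
structure SubsetFamily (m : ℕ) where
  base : FinGSet Gal(Ω/k)
  sub : base.carrier → Finset (Fin n)
  smul_mem_iff : ∀ (g : Gal(Ω/k)) (b : base.carrier) (s : Fin n),
    galoisToPerm e g s ∈ sub (g • b) ↔ s ∈ sub b
  card_sub : ∀ b, (sub b).card = m

namespace SubsetFamily

variable {e} {m : ℕ} (X : SubsetFamily e m)

theorem sub_smul (g : Gal(Ω/k)) (b : X.base.carrier) :
    X.sub (g • b) = (X.sub b).map (galoisToPerm e g).toEmbedding := by
  ext s
  rw [Finset.mem_map_equiv, ← X.smul_mem_iff g b ((galoisToPerm e g).symm s),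
    Equiv.apply_symm_apply]

/-- The coordinate ring of the affine bundle given by `X`: the equivariant families of polynomials
`r b`, where `r b` involves only the variables in `X.sub b`. -/
def coordRing : Subalgebra k (X.base.carrier → MvPolynomial (Fin n) Ω) where
  carrier := {r | (∀ (g : Gal(Ω/k)) (b : X.base.carrier), r (g • b) = semilinearAct e g (r b)) ∧
    ∀ b, killOutside Ω (X.sub b) (r b) = r b}
  mul_mem' := fun {p q} hp hq => ⟨fun g b => by simp [hp.1, hq.1], fun b => by simp [hp.2, hq.2]⟩
  add_mem' := fun {p q} hp hq => ⟨fun g b => by simp [hp.1, hq.1], fun b => by simp [hp.2, hq.2]⟩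
  algebraMap_mem' := fun c => ⟨fun g b => by
    rw [Pi.algebraMap_apply, Pi.algebraMap_apply, IsScalarTower.algebraMap_apply k Ω,
      MvPolynomial.algebraMap_eq, semilinearAct_C, AlgEquiv.commutes], fun b => by
    rw [Pi.algebraMap_apply, IsScalarTower.algebraMap_apply k Ω, AlgHom.commutes]⟩

/-- A trivialization of the bundle of coordinate subspaces given by `X`: elements `vec b j` of `L`,
constant on the orbits of the base, whose conjugates form an invertible matrix with rows indexed by
`X.sub b` and columns indexed by `J`, and the inverse matrix. -/
structure Frame (J : Type v) [Fintype J] [DecidableEq J] where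
  vec : X.base.carrier → J → L
  inv : X.base.carrier → J → Fin n → Ω
  vec_smul : ∀ (g : Gal(Ω/k)) (b : X.base.carrier), vec (g • b) = vec b
  vec_inv : ∀ b, ∀ s ∈ X.sub b, ∀ s' ∈ X.sub b,
    ∑ j, e.symm s (vec b j) * inv b j s' = if s = s' then 1 else 0
  inv_vec : ∀ b j j', ∑ s ∈ X.sub b, inv b j s * e.symm s (vec b j') = if j = j' then 1 else 0

namespace Frame

variable {X} {J : Type v} [Fintype J] [DecidableEq J] (F : X.Frame J)

/-- The substitution expressing the variables `x_s` in the coordinates of the frame. -/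
def toFrame (b : X.base.carrier) : MvPolynomial (Fin n) Ω →ₐ[Ω] MvPolynomial J Ω :=
  MvPolynomial.aeval fun s => ∑ j, MvPolynomial.C (e.symm s (F.vec b j)) * MvPolynomial.X j

/-- The substitution expressing the coordinates of the frame in the variables `x_s`. -/
def ofFrame (b : X.base.carrier) : MvPolynomial J Ω →ₐ[Ω] MvPolynomial (Fin n) Ω :=
  MvPolynomial.aeval fun j => ∑ s ∈ X.sub b, MvPolynomial.C (F.inv b j s) * MvPolynomial.X s

theorem toFrame_X (b : X.base.carrier) (s : Fin n) : F.toFrame b (MvPolynomial.X s) =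
    ∑ j, MvPolynomial.C (e.symm s (F.vec b j)) * MvPolynomial.X j :=
  MvPolynomial.aeval_X _ s

theorem ofFrame_X (b : X.base.carrier) (j : J) : F.ofFrame b (MvPolynomial.X j) =
    ∑ s ∈ X.sub b, MvPolynomial.C (F.inv b j s) * MvPolynomial.X s :=
  MvPolynomial.aeval_X _ j

theorem toFrame_C (b : X.base.carrier) (c : Ω) :
    F.toFrame b (MvPolynomial.C c) = MvPolynomial.C c := (F.toFrame b).commutes c

theorem ofFrame_C (b : X.base.carrier) (c : Ω) :
    F.ofFrame b (MvPolynomial.C c) = MvPolynomial.C c := (F.ofFrame b).commutes c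

theorem toFrame_ofFrame (b : X.base.carrier) (q : MvPolynomial J Ω) :
    F.toFrame b (F.ofFrame b q) = q := by
  have : (F.toFrame b).comp (F.ofFrame b) = AlgHom.id Ω _ := by
    refine MvPolynomial.algHom_ext fun j => ?_
    simp only [AlgHom.comp_apply, ofFrame_X, map_sum, map_mul, toFrame_X, toFrame_C,
      Finset.mul_sum, AlgHom.id_apply]
    rw [Finset.sum_comm]
    simp only [← mul_assoc, ← map_mul, ← Finset.sum_mul, ← map_sum, F.inv_vec]
    simp
  exact DFunLike.congr_fun this q

theorem ofFrame_toFrame (b : X.base.carrier) (p : MvPolynomial (Fin n) Ω) :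
    F.ofFrame b (F.toFrame b (killOutside Ω (X.sub b) p)) = killOutside Ω (X.sub b) p := by
  have : ((F.ofFrame b).comp (F.toFrame b)).comp (killOutside Ω (X.sub b)) =
      killOutside Ω (X.sub b) := by
    refine MvPolynomial.algHom_ext fun s => ?_
    by_cases hs : s ∈ X.sub b
    · simp only [AlgHom.comp_apply, killOutside_X, if_pos hs, ofFrame_X, map_sum, map_mul,
        toFrame_X, ofFrame_C, Finset.mul_sum]
      rw [Finset.sum_comm]
      simp only [← mul_assoc, ← map_mul, ← Finset.sum_mul, ← map_sum]
      rw [Finset.sum_congr rfl fun s' hs' => by rw [F.vec_inv b s hs s' hs']]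
      simp [hs]
    · simp [killOutside_X, if_neg hs]
  exact DFunLike.congr_fun this p

theorem killOutside_ofFrame (b : X.base.carrier) (q : MvPolynomial J Ω) :
    killOutside Ω (X.sub b) (F.ofFrame b q) = F.ofFrame b q := by
  have : (killOutside Ω (X.sub b)).comp (F.ofFrame b) = F.ofFrame b := by
    refine MvPolynomial.algHom_ext fun j => ?_
    simp only [AlgHom.comp_apply, ofFrame_X, map_sum, map_mul, killOutside_C, killOutside_X]
    exact Finset.sum_congr rfl fun s hs => by rw [if_pos hs]
  exact DFunLike.congr_fun this q

theorem toFrame_semilinearAct (g : Gal(Ω/k)) (b : X.base.carrier) (p : MvPolynomial (Fin n) Ω) :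
    F.toFrame (g • b) (semilinearAct e g p) =
      MvPolynomial.map (g : Ω →+* Ω) (F.toFrame b p) := by
  have : (F.toFrame (g • b)).toRingHom.comp (semilinearAct e g) =
      (MvPolynomial.map (g : Ω →+* Ω)).comp (F.toFrame b).toRingHom := by
    refine MvPolynomial.ringHom_ext (fun c => ?_) fun s => ?_
    · simp [semilinearAct_C]
    · simp [semilinearAct_X, toFrame_X, F.vec_smul, symm_galoisToPerm]
  exact DFunLike.congr_fun this p

theorem ofFrame_map (g : Gal(Ω/k)) (b : X.base.carrier) (q : MvPolynomial J Ω) :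
    F.ofFrame (g • b) (MvPolynomial.map (g : Ω →+* Ω) q) = semilinearAct e g (F.ofFrame b q) := by
  conv_lhs => rw [← F.toFrame_ofFrame b q, ← F.toFrame_semilinearAct]
  have h := killOutside_semilinearAct e g (X.smul_mem_iff g b) (F.ofFrame b q)
  rw [F.killOutside_ofFrame] at h
  rw [← h, F.ofFrame_toFrame]

/-- Evaluation of an equivariant map at a point. -/
def evalAt (B : FinGSet Gal(Ω/k)) (b : B.carrier) : equivariantMaps B →ₐ[k] Ω :=
  (Pi.evalAlgHom k (fun _ => Ω) b).comp (equivariantMaps B).val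

/-- Polynomials in the coordinates of a frame, with equivariant coefficients, as functions on the
bundle. -/
def polyToCoordRing : MvPolynomial J (equivariantMaps X.base) →ₐ[k] X.coordRing :=
  AlgHom.codRestrict
    (AlgHom.pi fun b => ((F.ofFrame b).restrictScalars k).comp
      (MvPolynomial.mapAlgHom (evalAt X.base b))) X.coordRing (fun f => by
    refine ⟨fun g b => ?_, fun b => F.killOutside_ofFrame b _⟩
    change F.ofFrame (g • b) (MvPolynomial.map _ f) = semilinearAct e g (F.ofFrame b _)
    rw [← F.ofFrame_map]
    congr 1
    change _ = MvPolynomial.map _ (MvPolynomial.map _ f)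
    rw [MvPolynomial.map_map]
    exact congrArg (fun φ => MvPolynomial.map φ f) (RingHom.ext fun x => x.2 g b))

theorem toFrame_polyToCoordRing (f : MvPolynomial J (equivariantMaps X.base))
    (b : X.base.carrier) : F.toFrame b ((F.polyToCoordRing f).1 b) =
      MvPolynomial.map (evalAt X.base b : equivariantMaps X.base →+* Ω) f :=
  F.toFrame_ofFrame b _

theorem polyToCoordRing_bijective : Function.Bijective F.polyToCoordRing := by
  constructor
  · intro f f' h
    ext d b
    have := congrArg (fun r => MvPolynomial.coeff d (F.toFrame b (r.1 b))) h
    simp only [toFrame_polyToCoordRing, MvPolynomial.coeff_map] at this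
    exact this
  · intro r
    have hc : ∀ d : J →₀ ℕ, (fun b => MvPolynomial.coeff d (F.toFrame b (r.1 b))) ∈
        equivariantMaps X.base := fun d g b => by
      simp only [r.2.1 g b, F.toFrame_semilinearAct, MvPolynomial.coeff_map]
      rfl
    have := Fintype.ofFinite X.base.carrier
    classical
    let T : Finset (J →₀ ℕ) := Finset.univ.biUnion fun b => (F.toFrame b (r.1 b)).support
    refine ⟨∑ d ∈ T, MvPolynomial.monomial d ⟨_, hc d⟩, Subtype.ext (funext fun b => ?_)⟩
    have hb : ∀ r' : X.coordRing, F.ofFrame b (F.toFrame b (r'.1 b)) = r'.1 b := fun r' => by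
      rw [← r'.2.2 b, F.ofFrame_toFrame]
    rw [← hb, ← hb r, toFrame_polyToCoordRing]
    congr 1
    rw [map_sum]
    simp only [MvPolynomial.map_monomial]
    conv_rhs => rw [MvPolynomial.as_sum (F.toFrame b (r.1 b))]
    symm
    refine Finset.sum_subset
      (Finset.subset_biUnion_of_mem (fun b => (F.toFrame b (r.1 b)).support)
        (Finset.mem_univ b)) fun d _ hd => ?_
    rw [MvPolynomial.notMem_support_iff.1 hd, map_zero]

/-- A frame identifies the bundle with an affine space over the base. -/
def coordRingEquiv : MvPolynomial J (equivariantMaps X.base) ≃ₐ[k] X.coordRing :=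
  AlgEquiv.ofBijective F.polyToCoordRing F.polyToCoordRing_bijective

end Frame

end SubsetFamily

end

/-! ### Existence of frames, and points of the coordinate ring -/

section

variable {k : Type u} [Field k] {Ω : Type u} [Field Ω] [Algebra k Ω] [IsSepClosure k Ω]
  {L : Type u} [CommRing L] [Algebra k L] [Module.Finite k L] {n : ℕ}

/-- By the linear independence of the embeddings, the vectors of conjugates of elements of `L`
span the whole space. -/
theorem span_conjugates {k : Type u} [Field k] {Ω : Type u} [Field Ω] [Algebra k Ω] {L : Type u}
    [CommRing L] [Algebra k L] {n : ℕ} (e : (L →ₐ[k] Ω) ≃ Fin n) (D : Finset (Fin n)) :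
    Submodule.span Ω (Set.range fun (x : L) (s : D) => e.symm s x) = ⊤ := by
  by_contra h
  obtain ⟨f, hf, hle⟩ := Submodule.exists_le_ker_of_lt_top _ (lt_top_iff_ne_top.2 h)
  refine hf (LinearMap.pi_ext' fun s => LinearMap.ext_ring ?_)
  have hli : LinearIndependent Ω fun s : D => (e.symm s : L →ₐ[k] Ω).toLinearMap :=
    (linearIndependent_toLinearMap k L Ω).comp (fun s : D => e.symm s)
      (e.symm.injective.comp Subtype.val_injective)
  refine Fintype.linearIndependent_iff.1 hli (fun s => f (Pi.single s 1)) ?_ s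
  ext x
  have hx : f (fun s : D => e.symm s x) = 0 := hle (Submodule.subset_span ⟨x, rfl⟩)
  rw [LinearMap.pi_apply_eq_sum_univ f] at hx
  rw [LinearMap.zero_apply, ← hx, LinearMap.sum_apply]
  refine Finset.sum_congr rfl fun s _ => ?_
  have hs : (Pi.single s 1 : D → Ω) = fun j => if s = j then 1 else 0 := by
    ext i
    simp [Pi.single_apply, eq_comm]
  rw [LinearMap.smul_apply, smul_eq_mul, smul_eq_mul, mul_comm, hs]
  rfl

/-- Some `m` elements of `L` have an invertible matrix of conjugates with respect to a given set
`D` of `m` embeddings. The values of `N` outside `D` are irrelevant. -/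
theorem exists_invertible_conjugates {k : Type u} [Field k] {Ω : Type u} [Field Ω] [Algebra k Ω]
    {L : Type u} [CommRing L] [Algebra k L] {n : ℕ} (e : (L →ₐ[k] Ω) ≃ Fin n) {m : ℕ}
    (D : Finset (Fin n)) (hD : D.card = m) : ∃ (v : Fin m → L) (N : Fin m → Fin n → Ω),
      (∀ s ∈ D, ∀ s' ∈ D, ∑ j, e.symm s (v j) * N j s' = if s = s' then 1 else 0) ∧
      ∀ j j', ∑ s ∈ D, N j s * e.symm s (v j') = if j = j' then 1 else 0 := by
  classical
  obtain ⟨f, hf, hspan, hli⟩ := Submodule.exists_fun_fin_finrank_span_eq Ω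
    (Set.range fun (x : L) (s : D) => e.symm s x)
  have hfin : Module.finrank Ω (Submodule.span Ω (Set.range fun (x : L) (s : D) => e.symm s x)) =
      m := by
    rw [span_conjugates, finrank_top, Module.finrank_fintype_fun_eq_card, Fintype.card_coe, hD]
  have hspan' := hspan.trans (span_conjugates e D)
  let b := (Module.Basis.mk hli hspan'.ge).reindex (finCongr hfin)
  choose v hv using fun j => hf ((finCongr hfin).symm j)
  have hb : ∀ j, b j = fun s : D => e.symm s (v j) := fun j => by
    rw [Module.Basis.reindex_apply, Module.Basis.mk_apply]
    exact (hv j).symm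
  refine ⟨v, fun j s => if hs : s ∈ D then b.repr (Pi.single ⟨s, hs⟩ 1) j else 0,
    fun s hs s' hs' => ?_, fun j j' => ?_⟩
  · have h := congrFun (b.sum_repr (Pi.single ⟨s', hs'⟩ 1)) ⟨s, hs⟩
    simp only [hb, Finset.sum_apply, Pi.smul_apply, smul_eq_mul, Pi.single_apply,
      Subtype.mk.injEq] at h
    simp only [dif_pos hs', ← h]
    exact Finset.sum_congr rfl fun j _ => mul_comm _ _
  · have h : ∑ s : D, e.symm s (v j') • (Pi.single s 1 : D → Ω) = b j' := by
      rw [hb]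
      funext s
      simp [Finset.sum_apply, Pi.single_apply]
    have h2 := congrArg (fun x => b.repr x j) h
    simp only [map_sum, map_smul, Finsupp.coe_finsetSum, Finset.sum_apply, Finsupp.smul_apply,
      smul_eq_mul, b.repr_self, Finsupp.single_apply] at h2
    rw [← Finset.sum_coe_sort]
    simp only [eq_comm (a := j), ← h2]
    exact Finset.sum_congr rfl fun s _ => by simp [mul_comm]

variable {e : (L →ₐ[k] Ω) ≃ Fin n} {m : ℕ}

namespace SubsetFamily

/-- Every family of subsets has a frame. This is the triviality of vector bundles on étale
schemes over a field. -/
theorem nonempty_frame (X : SubsetFamily e m) : Nonempty (X.Frame (Fin m)) := by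
  classical
  let P : X.base.carrier → (Fin m → L) → Prop := fun b v => ∃ N : Fin m → Fin n → Ω,
      (∀ s ∈ X.sub b, ∀ s' ∈ X.sub b,
        ∑ j, e.symm s (v j) * N j s' = if s = s' then 1 else 0) ∧
      ∀ j j', ∑ s ∈ X.sub b, N j s * e.symm s (v j') = if j = j' then 1 else 0
  have hP : ∀ b, ∃ v, P b v := fun b => exists_invertible_conjugates e (X.sub b) (X.card_sub b)
  have hPg : ∀ (g : Gal(Ω/k)) b v, P b v → P (g • b) v := by
    rintro g b v ⟨N, h1, h2⟩
    refine ⟨fun j s => g (N j ((galoisToPerm e g).symm s)), ?_, ?_⟩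
    · rw [sub_smul]
      simp only [Finset.forall_mem_map, Equiv.coe_toEmbedding, Equiv.symm_apply_apply,
        symm_galoisToPerm, ← map_mul, ← map_sum]
      intro s hs s' hs'
      rw [h1 s hs s' hs']
      simp
    · intro j j'
      rw [sub_smul, Finset.sum_map]
      simp only [Equiv.coe_toEmbedding, Equiv.symm_apply_apply, symm_galoisToPerm, ← map_mul,
        ← map_sum, h2]
      split_ifs <;> simp
  choose v hv using hP
  -- The elements are chosen for one point of each orbit, and used for the whole orbit.
  let q : X.base.carrier → X.base.carrier := fun b =>
    (Quotient.mk (MulAction.orbitRel Gal(Ω/k) X.base.carrier) b).out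
  have hq : ∀ b, P b (v (q b)) := fun b => by
    obtain ⟨g, hg⟩ := MulAction.orbitRel_apply.1
      ((MulAction.orbitRel Gal(Ω/k) X.base.carrier).symm (Quotient.mk_out b))
    have := hPg g (q b) (v (q b)) (hv (q b))
    rwa [show g • q b = b from hg] at this
  choose N hN using hq
  refine ⟨⟨fun b => v (q b), N, fun g b => ?_, fun b => (hN b).1, fun b => (hN b).2⟩⟩
  have : q (g • b) = q b := congrArg Quotient.out (Quotient.sound
    (s := MulAction.orbitRel Gal(Ω/k) X.base.carrier) ⟨g, rfl⟩)
  rw [this]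

instance finiteType_coordRing (X : SubsetFamily e m) : Algebra.FiniteType k X.coordRing := by
  obtain ⟨F⟩ := X.nonempty_frame
  exact Algebra.FiniteType.equiv
    (Algebra.FiniteType.trans (S := equivariantMaps X.base) inferInstance inferInstance)
    F.coordRingEquiv

theorem specClass_coordRing (X : SubsetFamily e m) :
    specClass k X.coordRing = art k Ω X.base.cls * lefschetz k ^ m := by
  obtain ⟨F⟩ := X.nonempty_frame
  have : Algebra.FiniteType k (MvPolynomial (Fin m) (equivariantMaps X.base)) :=
    Algebra.FiniteType.trans (S := equivariantMaps X.base) inferInstance inferInstance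
  rw [art_cls, ← specClass_mvPolynomial]
  exact (specClass_congr F.coordRingEquiv).symm

/-- A function supported on a single fibre is integral over the coordinate ring: the constants are
algebraic over `k`, the indicator function of `b` is idempotent, and the frame coordinates on the
fibre extend to elements of the coordinate ring. -/
theorem isIntegral_single (X : SubsetFamily e m) [DecidableEq X.base.carrier] (b : X.base.carrier)
    (p : MvPolynomial (Fin n) Ω) : IsIntegral X.coordRing
      (Pi.single b (killOutside Ω (X.sub b) p) : X.base.carrier → MvPolynomial (Fin n) Ω) := by
  classical
  obtain ⟨F⟩ := X.nonempty_frame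
  have key : ∀ q : MvPolynomial (Fin m) Ω, IsIntegral X.coordRing
      (Pi.single b (F.ofFrame b q) : X.base.carrier → MvPolynomial (Fin n) Ω) := by
    intro q
    induction q using MvPolynomial.induction_on with
    | C c =>
      have h1 : IsIntegral k c := Algebra.IsIntegral.isIntegral c
      let φ : Ω →ₐ[k] (X.base.carrier → MvPolynomial (Fin n) Ω) := IsScalarTower.toAlgHom k Ω _
      have h2 := (h1.map φ).tower_top (A := X.coordRing)
      have h3 : IsIntegral X.coordRing
          (Pi.single b 1 : X.base.carrier → MvPolynomial (Fin n) Ω) := by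
        refine ⟨Polynomial.X ^ 2 - Polynomial.X, ?_, ?_⟩
        · monicity!
        · rw [← Polynomial.aeval_def]
          simp [pow_two, ← Pi.single_mul]
      have h4 : (Pi.single b (F.ofFrame b (MvPolynomial.C c)) :
          X.base.carrier → MvPolynomial (Fin n) Ω) = φ c * Pi.single b 1 := by
        funext b'
        by_cases hb : b' = b
        · subst hb
          simp [φ, F.ofFrame_C, MvPolynomial.algebraMap_eq]
        · simp [hb]
      rw [h4]
      exact h2.mul h3
    | add p q hp hq =>
      rw [map_add, Pi.single_add]
      exact hp.add hq
    | mul_X q j hq =>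
      have h1 : IsIntegral X.coordRing (F.polyToCoordRing (MvPolynomial.X j)).1 :=
        isIntegral_algebraMap (x := F.polyToCoordRing (MvPolynomial.X j))
      have h2 : (Pi.single b (F.ofFrame b (q * MvPolynomial.X j)) :
          X.base.carrier → MvPolynomial (Fin n) Ω) =
          Pi.single b (F.ofFrame b q) * (F.polyToCoordRing (MvPolynomial.X j)).1 := by
        funext b'
        by_cases hb : b' = b
        · subst hb
          rw [Pi.mul_apply, Pi.single_eq_same, Pi.single_eq_same, map_mul]
          congr 1
          change _ = F.ofFrame b' (MvPolynomial.map _ (MvPolynomial.X j))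
          rw [MvPolynomial.map_X]
        · simp [hb]
      rw [h2]
      exact hq.mul h1
  rw [← F.ofFrame_toFrame]
  exact key _

/-- Every prime ideal of the coordinate ring comes from a point of one of the fibres of the bundle
over the separable closure. -/
theorem exists_ringHom_of_isPrime (X : SubsetFamily e m) (p : Ideal X.coordRing) [p.IsPrime] :
    ∃ (b : X.base.carrier) (κ : Type u) (_ : CommRing κ) (_ : IsDomain κ)
      (φ : MvPolynomial (Fin n) Ω →+* κ), ∀ a : X.coordRing, a ∈ p ↔ φ (a.1 b) = 0 := by
  classical
  have : Fintype X.base.carrier := Fintype.ofFinite _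
  let ι : X.base.carrier → MvPolynomial (Fin n) Ω →ₙ+*
      (X.base.carrier → MvPolynomial (Fin n) Ω) := fun b =>
    { toFun := fun p => Pi.single b (killOutside Ω (X.sub b) p)
      map_mul' := fun x y => by rw [map_mul, Pi.single_mul]
      map_zero' := by rw [map_zero, Pi.single_zero]
      map_add' := fun x y => by rw [map_add, Pi.single_add] }
  have hsum : ∑ b, ι b 1 = 1 := by
    funext b
    rw [Finset.sum_apply]
    change ∑ b', (Pi.single b' (killOutside Ω (X.sub b') 1) : X.base.carrier → _) b = 1
    rw [Finset.sum_eq_single b]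
    · simp
    · intro b' _ hb
      rw [Pi.single_eq_of_ne hb.symm]
    · simp
  obtain ⟨b, κ, _, hκ, φ, h⟩ := exists_ringHom_of_isIntegral (R := X.coordRing)
    Subtype.val_injective ι (fun b x => X.isIntegral_single b x) hsum p
  refine ⟨b, κ, _, hκ, φ, fun a => h a _ ?_⟩
  funext b'
  change (Pi.single b (killOutside Ω (X.sub b) (a.1 b)) : X.base.carrier → _) b' =
    a.1 b' * (Pi.single b (killOutside Ω (X.sub b) 1) : X.base.carrier → _) b'
  rw [a.2.2, map_one]
  by_cases hb : b' = b
  · subst hb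
    simp
  · simp [hb]

end SubsetFamily
end

/-! ### Stratification by the number of vanishing coordinates -/

section

variable {k : Type u} [Field k] {Ω : Type u} [Field Ω] [Algebra k Ω] [IsSepClosure k Ω]
  {L : Type u} [CommRing L] [Algebra k L] [Module.Finite k L] {n : ℕ}

/-- The elementary symmetric polynomial of degree `j` in the variables indexed by `D`. -/
def elemSymm (Ω : Type u) [Field Ω] {n : ℕ} (D : Finset (Fin n)) (j : ℕ) :
    MvPolynomial (Fin n) Ω :=
  ∑ t ∈ D.powersetCard j, ∏ s ∈ t, MvPolynomial.X s

theorem elemSymm_zero (D : Finset (Fin n)) : elemSymm Ω D 0 = 1 := by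
  simp [elemSymm]

theorem elemSymm_card (D : Finset (Fin n)) : elemSymm Ω D D.card = ∏ s ∈ D, MvPolynomial.X s := by
  simp [elemSymm]

theorem elemSymm_of_card_lt {D : Finset (Fin n)} {j : ℕ} (h : D.card < j) :
    elemSymm Ω D j = 0 := by
  rw [elemSymm, Finset.powersetCard_eq_empty.2 h, Finset.sum_empty]

/-- At a point where the variables in `D \ D'` vanish, the elementary symmetric polynomials in the
variables indexed by `D` and by `D'` have the same values. -/
theorem map_elemSymm_of_subset {κ : Type*} [CommRing κ] (φ : MvPolynomial (Fin n) Ω →+* κ)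
    {D D' : Finset (Fin n)} (h : D' ⊆ D) (h0 : ∀ s ∈ D, s ∉ D' → φ (MvPolynomial.X s) = 0)
    (j : ℕ) : φ (elemSymm Ω D j) = φ (elemSymm Ω D' j) := by
  rw [elemSymm, elemSymm, map_sum, map_sum]
  symm
  refine Finset.sum_subset (Finset.powersetCard_mono h) fun t ht ht' => ?_
  rw [Finset.mem_powersetCard] at ht ht'
  obtain ⟨s, hs, hs'⟩ := Finset.not_subset.1 fun h' => ht' ⟨h', ht.2⟩
  rw [map_prod]
  exact Finset.prod_eq_zero hs (h0 s (ht.1 hs) hs')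

theorem killOutside_elemSymm {D D' : Finset (Fin n)} (h : D' ⊆ D) (j : ℕ) :
    killOutside Ω D' (elemSymm Ω D j) = elemSymm Ω D' j := by
  refine (map_elemSymm_of_subset (killOutside Ω D').toRingHom h (fun s _ hs => ?_) j).trans ?_
  · exact (killOutside_X D' s).trans (if_neg hs)
  · change killOutside Ω D' (elemSymm Ω D' j) = _
    rw [elemSymm, map_sum]
    refine Finset.sum_congr rfl fun t ht => ?_
    rw [map_prod]
    refine Finset.prod_congr rfl fun s hs => ?_
    rw [killOutside_X, if_pos ((Finset.mem_powersetCard.1 ht).1 hs)]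

variable {e : (L →ₐ[k] Ω) ≃ Fin n} {m : ℕ}

theorem semilinearAct_elemSymm (g : Gal(Ω/k)) (D : Finset (Fin n)) (j : ℕ) :
    semilinearAct e g (elemSymm Ω D j) =
      elemSymm Ω (D.map (galoisToPerm e g).toEmbedding) j := by
  rw [elemSymm, elemSymm, Finset.powersetCard_map, Finset.sum_map, map_sum]
  refine Finset.sum_congr rfl fun t _ => ?_
  rw [map_prod]
  refine Eq.trans ?_ (Finset.prod_map t (galoisToPerm e g).toEmbedding MvPolynomial.X).symm
  exact Finset.prod_congr rfl fun s _ => semilinearAct_X e g s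

namespace SubsetFamily

/-- The elementary symmetric functions of the coordinates, as functions on the bundle. -/
def esymm (X : SubsetFamily e m) (j : ℕ) : X.coordRing :=
  ⟨fun b => elemSymm Ω (X.sub b) j, fun g b => by
    change elemSymm Ω (X.sub (g • b)) j = semilinearAct e g (elemSymm Ω (X.sub b) j)
    rw [semilinearAct_elemSymm, sub_smul],
    fun _ => killOutside_elemSymm (Finset.Subset.refl _) j⟩

/-- The coordinate ring of the bundle of tori contained in the bundle of coordinate subspaces: all
the coordinates are invertible. -/
abbrev TorusAlgebra (X : SubsetFamily e m) : Type u := Localization.Away (X.esymm m)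

/-- The `G`-set of all pairs `(b, Z)`, where `Z` is an `i`-element subset of `X.sub b`. -/
def zeroBase (X : SubsetFamily e m) (i : ℕ) : FinGSet Gal(Ω/k) where
  carrier := {x : X.base.carrier × Finset (Fin n) // x.2 ∈ (X.sub x.1).powersetCard i}
  action :=
    { smul := fun g x => ⟨(g • x.1.1, x.1.2.map (galoisToPerm e g).toEmbedding), by
        obtain ⟨h1, h2⟩ := Finset.mem_powersetCard.1 x.2
        rw [sub_smul, Finset.mem_powersetCard]
        exact ⟨Finset.map_subset_map.2 h1, (Finset.card_map _).trans h2⟩⟩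
      one_smul := fun x => Subtype.ext (Prod.ext (one_smul _ _) (by
        change x.1.2.map (galoisToPerm e 1).toEmbedding = x.1.2
        rw [map_one]
        exact Finset.map_refl))
      mul_smul := fun g h x => Subtype.ext (Prod.ext (mul_smul _ _ _) (by
        change x.1.2.map (galoisToPerm e (g * h)).toEmbedding =
          (x.1.2.map (galoisToPerm e h).toEmbedding).map (galoisToPerm e g).toEmbedding
        rw [map_mul, Finset.map_map]
        rfl)) }
  isOpen_stabilizer := fun x => by
    refine Subgroup.isOpen_mono (H₁ := MulAction.stabilizer Gal(Ω/k) x.1.1 ⊓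
      (galoisToPerm e).toMonoidHom.ker) (fun g hg => ?_) ?_
    · obtain ⟨h1, h2⟩ := hg
      refine Subtype.ext (Prod.ext h1 ?_)
      change x.1.2.map (galoisToPerm e g).toEmbedding = x.1.2
      rw [show galoisToPerm e g = 1 from h2]
      exact Finset.map_refl
    · rw [Subgroup.coe_inf]
      exact (X.base.isOpen_stabilizer x.1.1).inter
        ((isOpen_discrete {1}).preimage (galoisToPerm e).continuous_toFun)

/-- The coordinate subspaces of the fibres of the bundle on which the coordinates in an `i`-element
set `Z` vanish. -/
def zeroFamily (X : SubsetFamily e m) (i : ℕ) : SubsetFamily e (m - i) where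
  base := X.zeroBase i
  sub := fun x => X.sub x.1.1 \ x.1.2
  smul_mem_iff := fun g x s => by
    change _ ∈ X.sub (g • x.1.1) \ x.1.2.map (galoisToPerm e g).toEmbedding ↔ _
    rw [Finset.mem_sdiff, Finset.mem_sdiff, X.smul_mem_iff, Finset.mem_map_equiv,
      Equiv.symm_apply_apply]
  card_sub := fun x => by
    obtain ⟨h1, h2⟩ := Finset.mem_powersetCard.1 x.2
    rw [Finset.card_sdiff_of_subset h1, X.card_sub, h2]

/-- Restriction of functions to the coordinate subspaces of codimension `i`. -/
def restrictZero (X : SubsetFamily e m) (i : ℕ) :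
    X.coordRing →ₐ[k] (X.zeroFamily i).coordRing :=
  AlgHom.codRestrict
    ((AlgHom.pi fun x : (X.zeroBase i).carrier =>
      ((killOutside Ω (X.sub x.1.1 \ x.1.2)).restrictScalars k).comp
        (Pi.evalAlgHom k (fun _ => MvPolynomial (Fin n) Ω) x.1.1)).comp X.coordRing.val)
    (X.zeroFamily i).coordRing (fun r => by
      refine ⟨fun g x => ?_, fun x => ?_⟩
      · change killOutside Ω ((X.zeroFamily i).sub (g • x)) (r.1 (g • x.1.1)) =
          semilinearAct e g (killOutside Ω ((X.zeroFamily i).sub x) (r.1 x.1.1))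
        rw [r.2.1, killOutside_semilinearAct e g ((X.zeroFamily i).smul_mem_iff g x)]
      · change killOutside Ω ((X.zeroFamily i).sub x)
          (killOutside Ω ((X.zeroFamily i).sub x) (r.1 x.1.1)) = _
        rw [killOutside_killOutside, Finset.inter_self]
        rfl)

theorem restrictZero_esymm (X : SubsetFamily e m) (i j : ℕ) :
    X.restrictZero i (X.esymm j) = (X.zeroFamily i).esymm j :=
  Subtype.ext (funext fun _ => killOutside_elemSymm Finset.sdiff_subset j)

theorem esymm_of_lt (X : SubsetFamily e m) {j : ℕ} (h : m < j) : X.esymm j = 0 :=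
  Subtype.ext (funext fun b => elemSymm_of_card_lt ((X.card_sub b).trans_lt h))

theorem esymm_zero (X : SubsetFamily e m) : X.esymm 0 = 1 :=
  Subtype.ext (funext fun b => elemSymm_zero (X.sub b))

theorem esymm_apply (X : SubsetFamily e m) (b : X.base.carrier) :
    (X.esymm m).1 b = ∏ s ∈ X.sub b, MvPolynomial.X s := by
  rw [← elemSymm_card, X.card_sub]
  rfl

/-- After multiplication with the product of the coordinates, every function on the bundle of
coordinate subspaces of codimension `i` extends to the whole bundle. -/
theorem exists_restrictZero_eq (X : SubsetFamily e m) (i : ℕ) (h : (X.zeroFamily i).coordRing) :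
    ∃ r, X.restrictZero i r = h * (X.zeroFamily i).esymm (m - i) := by
  classical
  have : Fintype (X.zeroFamily i).base.carrier := Fintype.ofFinite _
  let u := h * (X.zeroFamily i).esymm (m - i)
  have hu : ∀ x, u.1 x = h.1 x * ∏ s ∈ (X.zeroFamily i).sub x, MvPolynomial.X s := fun x => by
    rw [← esymm_apply]
    rfl
  let proj : (X.zeroFamily i).base.carrier → X.base.carrier := fun x => x.1.1
  have hproj : ∀ (g : Gal(Ω/k)) x, proj (g • x) = g • proj x := fun _ _ => rfl
  -- The summand belonging to `Z` vanishes on the subspaces belonging to the other `i`-element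
  -- sets, since one of the coordinates in its factor `∏ x_s` is zero there.
  let r : X.base.carrier → MvPolynomial (Fin n) Ω := fun b =>
    ∑ x with proj x = b, u.1 x
  have hr : r ∈ X.coordRing := by
    refine ⟨fun g b => ?_, fun b => ?_⟩
    · rw [map_sum]
      refine (Finset.sum_equiv (MulAction.toPerm g) (fun x => ?_) fun x _ => ?_).symm
      · rw [Finset.mem_filter, Finset.mem_filter, MulAction.toPerm_apply, hproj]
        simp
      · rw [MulAction.toPerm_apply, u.2.1]
    · rw [map_sum]
      refine Finset.sum_congr rfl fun x hx => ?_
      rw [← u.2.2, killOutside_killOutside]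
      congr 1
      obtain ⟨-, rfl⟩ := Finset.mem_filter.1 hx
      rw [Finset.inter_eq_right.2 (show (X.zeroFamily i).sub x ⊆ X.sub (proj x) from
        Finset.sdiff_subset)]
  refine ⟨⟨r, hr⟩, Subtype.ext (funext fun x => ?_)⟩
  change killOutside Ω ((X.zeroFamily i).sub x) (r (proj x)) = u.1 x
  rw [map_sum, Finset.sum_eq_single x]
  · exact u.2.2 x
  · intro y hy hyx
    obtain ⟨-, hy⟩ := Finset.mem_filter.1 hy
    obtain ⟨s, hs, hs'⟩ : ∃ s ∈ x.1.2, s ∉ y.1.2 := by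
      by_contra! h'
      refine hyx (Subtype.ext (Prod.ext hy (Finset.eq_of_subset_of_card_le h' ?_).symm))
      rw [(Finset.mem_powersetCard.1 x.2).2, (Finset.mem_powersetCard.1 y.2).2]
    have hsX : s ∈ X.sub y.1.1 := by
      rw [show y.1.1 = x.1.1 from hy]
      exact (Finset.mem_powersetCard.1 x.2).1 hs
    rw [hu, map_mul, map_prod, Finset.prod_eq_zero (i := s), mul_zero]
    · exact Finset.mem_sdiff.2 ⟨hsX, hs'⟩
    · rw [killOutside_X, if_neg]
      exact fun h' => (Finset.mem_sdiff.1 h').2 hs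
  · exact fun hx => absurd (by simp) hx

/-- The ideal of functions generated by the elementary symmetric functions of the `i` highest
degrees: its zero locus consists of the points with at least `i` vanishing coordinates. -/
def zeroIdeal (X : SubsetFamily e m) (i : ℕ) : Ideal X.coordRing :=
  Ideal.span {f | ∃ j < i, f = X.esymm (m - j)}

theorem zeroIdeal_zero (X : SubsetFamily e m) : X.zeroIdeal 0 = ⊥ := by
  rw [zeroIdeal, Ideal.span_eq_bot]
  rintro _ ⟨j, hj, -⟩
  exact absurd hj (Nat.not_lt_zero j)

theorem restrictZero_zeroIdeal (X : SubsetFamily e m) {i : ℕ} (hi : i ≤ m) (a : X.coordRing)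
    (ha : a ∈ X.zeroIdeal i) : X.restrictZero i a = 0 := by
  have : X.zeroIdeal i ≤ RingHom.ker (X.restrictZero i) := by
    refine Ideal.span_le.2 ?_
    rintro _ ⟨j, hj, rfl⟩
    change X.restrictZero i _ = 0
    rw [restrictZero_esymm, esymm_of_lt _ (by omega)]
  exact this ha

/-- At a point where `zeroIdeal i` vanishes and the elementary symmetric function of degree `m - i`
does not, exactly `i` coordinates vanish, so that the point lies on one of the coordinate subspaces
of codimension `i`. -/
theorem mul_mem_radical_of_restrictZero_eq_zero (X : SubsetFamily e m) {i : ℕ} (hi : i ≤ m)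
    (a : X.coordRing) (ha : X.restrictZero i a = 0) :
    X.esymm (m - i) * a ∈ (X.zeroIdeal i).radical := by
  classical
  rw [Ideal.radical_eq_sInf, Ideal.mem_sInf]
  rintro p ⟨hIp, hp⟩
  by_cases hf : X.esymm (m - i) ∈ p
  · exact p.mul_mem_right _ hf
  refine p.mul_mem_left _ ?_
  obtain ⟨b, κ, _, _, φ, hφ⟩ := X.exists_ringHom_of_isPrime p
  -- The coordinates vanishing at the point `φ`.
  let Z := (X.sub b).filter fun s => φ (MvPolynomial.X s) = 0
  have hZ : Z ⊆ X.sub b := Finset.filter_subset _ _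
  have hcard : (X.sub b \ Z).card = m - Z.card := by
    rw [Finset.card_sdiff_of_subset hZ, X.card_sub]
  have hZm : Z.card ≤ m := (Finset.card_le_card hZ).trans (X.card_sub b).le
  have hsymm : ∀ j, X.esymm j ∈ p ↔ φ (elemSymm Ω (X.sub b \ Z) j) = 0 := fun j => by
    rw [hφ, ← map_elemSymm_of_subset φ (D := X.sub b) Finset.sdiff_subset]
    · rfl
    · intro s hs hs'
      have : s ∈ Z := by
        by_contra h
        exact hs' (Finset.mem_sdiff.2 ⟨hs, h⟩)
      exact (Finset.mem_filter.1 this).2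
  have h1 : Z.card ≤ i := by
    by_contra! h
    refine hf ((hsymm _).2 ?_)
    rw [elemSymm_of_card_lt (by omega), map_zero]
  have h2 : i ≤ Z.card := by
    by_contra! h
    have h3 : X.esymm (m - Z.card) ∈ p := hIp (Ideal.subset_span ⟨_, h, rfl⟩)
    rw [hsymm, ← hcard, elemSymm_card, map_prod, Finset.prod_eq_zero_iff] at h3
    obtain ⟨s, hs, hs'⟩ := h3
    obtain ⟨hs1, hs2⟩ := Finset.mem_sdiff.1 hs
    exact hs2 (Finset.mem_filter.2 ⟨hs1, hs'⟩)
  have h3 : killOutside Ω (X.sub b \ Z) (a.1 b) = 0 := congrFun (congrArg Subtype.val ha)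
    (⟨(b, Z), Finset.mem_powersetCard.2 ⟨hZ, le_antisymm h1 h2⟩⟩ : (X.zeroBase i).carrier)
  have h4 : (φ.comp (killOutside Ω (X.sub b \ Z)).toRingHom).comp
      (killOutside Ω (X.sub b)).toRingHom = φ.comp (killOutside Ω (X.sub b)).toRingHom := by
    refine MvPolynomial.ringHom_ext (fun c => ?_) fun s => ?_
    · simp
    · by_cases hs : s ∈ X.sub b
      · by_cases hs' : φ (MvPolynomial.X s) = 0
        · simp [killOutside_X, hs, hs', Z]
        · simp [killOutside_X, hs, hs', Z]
      · simp [killOutside_X, hs]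
  have h5 := DFunLike.congr_fun h4 (a.1 b)
  simp only [AlgHom.toRingHom_eq_coe, RingHom.comp_apply, RingHom.coe_coe, a.2.2] at h5
  rw [hφ, ← h5, h3, map_zero]

/-- The locus of points with exactly `i` vanishing coordinates has the class of the bundle of tori
over the pairs `(b, Z)` with `|Z| = i`. -/
theorem specClass_torusAlgebra_zeroFamily (X : SubsetFamily e m) {i : ℕ} (hi : i ≤ m) :
    specClass k (Localization.Away (Ideal.Quotient.mk (X.zeroIdeal i) (X.esymm (m - i)))) =
      specClass k (X.zeroFamily i).TorusAlgebra := by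
  let β : X.coordRing ⧸ X.zeroIdeal i →ₐ[k] (X.zeroFamily i).coordRing :=
    Ideal.Quotient.liftₐ _ (X.restrictZero i) (X.restrictZero_zeroIdeal hi)
  have hβ : ∀ a, β (Ideal.Quotient.mk _ a) = X.restrictZero i a := fun a => rfl
  have h := specClass_away_eq β (Ideal.Quotient.mk (X.zeroIdeal i) (X.esymm (m - i)))
    (fun c => ?_) fun a ha => ?_
  · rw [h, hβ, restrictZero_esymm]
  · obtain ⟨r, hr⟩ := X.exists_restrictZero_eq i c
    exact ⟨Ideal.Quotient.mk _ r, by rw [hβ, hβ, hr, restrictZero_esymm]⟩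
  · obtain ⟨a, rfl⟩ := Ideal.Quotient.mk_surjective a
    rw [← map_mul]
    obtain ⟨N, hN⟩ := X.mul_mem_radical_of_restrictZero_eq_zero hi a ha
    exact ⟨N, by rw [← map_pow]; exact Ideal.Quotient.eq_zero_iff_mem.2 hN⟩

theorem specClass_quotient_zeroIdeal (X : SubsetFamily e m) (i : ℕ) (hi : i ≤ m) :
    specClass k (X.coordRing ⧸ X.zeroIdeal i) = specClass k (X.zeroFamily i).TorusAlgebra +
      specClass k (X.coordRing ⧸ X.zeroIdeal (i + 1)) := by
  have hle : X.zeroIdeal i ≤ X.zeroIdeal (i + 1) :=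
    by
    refine Ideal.span_mono ?_
    rintro _ ⟨j, hj, rfl⟩
    exact ⟨j, hj.trans (Nat.lt_succ_self i), rfl⟩
  rw [← X.specClass_torusAlgebra_zeroFamily hi]
  refine specClass_eq_away_add (Ideal.Quotient.mk (X.zeroIdeal i) (X.esymm (m - i)))
    (Ideal.Quotient.factorₐ k hle) (Ideal.Quotient.factor_surjective hle) fun p hp => ?_
  constructor
  · intro h x hx
    obtain ⟨a, rfl⟩ := Ideal.Quotient.mk_surjective x
    have ha : a ∈ X.zeroIdeal (i + 1) := Ideal.Quotient.eq_zero_iff_mem.1 hx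
    have hle' : X.zeroIdeal (i + 1) ≤ p.comap (Ideal.Quotient.mk (X.zeroIdeal i)) := by
      refine Ideal.span_le.2 ?_
      rintro _ ⟨j, hj, rfl⟩
      rcases Nat.lt_succ_iff_lt_or_eq.1 hj with hj | rfl
      · change Ideal.Quotient.mk _ _ ∈ p
        rw [Ideal.Quotient.eq_zero_iff_mem.2
          (show X.esymm (m - j) ∈ X.zeroIdeal i from Ideal.subset_span ⟨j, hj, rfl⟩)]
        exact p.zero_mem
      · exact h
    exact hle' ha
  · exact fun h => h (Ideal.Quotient.eq_zero_iff_mem.2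
      (Ideal.subset_span ⟨i, Nat.lt_succ_self i, rfl⟩))

/-- The stratification of the affine bundle by the number of vanishing coordinates. -/
theorem sum_specClass_torusAlgebra (X : SubsetFamily e m) :
    ∑ i ∈ Finset.range (m + 1), specClass k (X.zeroFamily i).TorusAlgebra =
      art k Ω X.base.cls * lefschetz k ^ m := by
  have h : ∀ i ≤ m + 1, specClass k X.coordRing =
      ∑ j ∈ Finset.range i, specClass k (X.zeroFamily j).TorusAlgebra +
        specClass k (X.coordRing ⧸ X.zeroIdeal i) := by
    intro i
    induction i with
    | zero =>
      intro _
      rw [Finset.range_zero, Finset.sum_empty, zero_add]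
      refine specClass_eq_of_ker_le_nilradical (Ideal.Quotient.mkₐ k (X.zeroIdeal 0))
        Ideal.Quotient.mk_surjective ?_
      intro x hx
      have hx' : x ∈ X.zeroIdeal 0 := Ideal.Quotient.eq_zero_iff_mem.1 hx
      rw [zeroIdeal_zero, Ideal.mem_bot] at hx'
      rw [hx']
      exact zero_mem _
    | succ i ih =>
      intro hi
      rw [ih (by omega), X.specClass_quotient_zeroIdeal i (by omega), Finset.sum_range_succ,
        add_assoc]
  rw [← specClass_coordRing, h (m + 1) le_rfl]
  have : Subsingleton (X.coordRing ⧸ X.zeroIdeal (m + 1)) := by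
    refine Ideal.Quotient.subsingleton_iff.2 ((Ideal.eq_top_iff_one _).2 (Ideal.subset_span
      ⟨m, Nat.lt_succ_self m, ?_⟩))
    rw [Nat.sub_self, esymm_zero]
  rw [specClass_of_subsingleton, add_zero]

end SubsetFamily
end

/-! ### The torus of units as a family of coordinate subspaces -/

section

variable {k : Type u} [Field k] {Ω : Type u} [Field Ω] [Algebra k Ω]
  {L : Type u} [CommRing L] [Algebra k L] {n : ℕ}

/-- Over an extension containing all conjugates, the norm of an algebra split by `n` embeddings is
the product of the conjugates. -/
theorem norm_eq_prod_conjugates (σ : Fin n → (L →ₐ[k] Ω)) {J : Type*} [Fintype J] [DecidableEq J]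
    (b : Module.Basis J k L) (V : Matrix J (Fin n) Ω)
    (hUV : (Matrix.of fun s j => σ s (b j)) * V = 1)
    (hVU : V * (Matrix.of fun s j => σ s (b j)) = 1)
    {R : Type*} [CommRing R] [Algebra k R] [Algebra Ω R] [IsScalarTower k Ω R] (y : R ⊗[k] L) :
    Algebra.norm R y = ∏ s, Algebra.TensorProduct.lift (Algebra.ofId R R)
      ((IsScalarTower.toAlgHom k Ω R).comp (σ s)) (fun _ _ => Commute.all _ _) y := by
  -- The matrix of conjugates diagonalizes multiplication by `y`.
  let τ : Fin n → (R ⊗[k] L →ₐ[R] R) := fun s => Algebra.TensorProduct.lift (Algebra.ofId R R)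
      ((IsScalarTower.toAlgHom k Ω R).comp (σ s)) (fun _ _ => Commute.all _ _)
  have hτ : ∀ s j, τ s (b.baseChange R j) = algebraMap Ω R (σ s (b j)) := fun s j => by
    simp [τ]
  let U' : Matrix (Fin n) J R := (Matrix.of fun s j => σ s (b j)).map (algebraMap Ω R)
  let V' : Matrix J (Fin n) R := V.map (algebraMap Ω R)
  have hUV' : U' * V' = 1 := by
    rw [← Matrix.map_mul, hUV, Matrix.map_one _ (map_zero _) (map_one _)]
  have hVU' : V' * U' = 1 := by
    rw [← Matrix.map_mul, hVU, Matrix.map_one _ (map_zero _) (map_one _)]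
  let M := Algebra.leftMulMatrix (b.baseChange R) y
  have hM : Matrix.diagonal (fun s => τ s y) * U' = U' * M := by
    ext s i
    rw [Matrix.diagonal_mul, Matrix.mul_apply]
    have h1 : y * b.baseChange R i = ∑ l, M l i • b.baseChange R l := by
      conv_lhs => rw [← (b.baseChange R).sum_repr (y * b.baseChange R i)]
      exact Finset.sum_congr rfl fun l _ =>
        congrArg (· • _) (Algebra.leftMulMatrix_eq_repr_mul (b.baseChange R) y l i).symm
    have h2 := congrArg (τ s) h1
    rw [map_mul, hτ, map_sum] at h2
    refine h2.trans (Finset.sum_congr rfl fun l _ => ?_)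
    rw [map_smul, hτ, smul_eq_mul, mul_comm]
    rfl
  have hM' : M = V' * Matrix.diagonal (fun s => τ s y) * U' := by
    rw [Matrix.mul_assoc, hM, ← Matrix.mul_assoc, hVU', Matrix.one_mul]
  rw [Algebra.norm_eq_matrix_det (b.baseChange R)]
  change M.det = _
  rw [hM', Matrix.det_conj_of_mul_eq_one hVU' hUV', Matrix.det_diagonal]

variable [IsSepClosure k Ω] [Module.Finite k L]

namespace SubsetFamily

/-- The family consisting of the full set of embeddings, over the point. -/
def full (e : (L →ₐ[k] Ω) ≃ Fin n) : SubsetFamily e n where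
  base := FinGSet.point _
  sub := fun _ => Finset.univ
  smul_mem_iff := fun _ _ _ => by simp
  card_sub := fun _ => by simp

/-- The algebra of equivariant functions on the one-point set is `k`, the fixed field of the Galois
group. -/
def fullBaseEquiv (e : (L →ₐ[k] Ω) ≃ Fin n) : k ≃ₐ[k] equivariantMaps (full e).base :=
  AlgEquiv.ofBijective (Algebra.ofId k _) ⟨fun x y h =>
    (algebraMap k Ω).injective (congrFun (congrArg Subtype.val h) ()), fun f => by
    obtain ⟨c, hc⟩ := (InfiniteGalois.mem_range_algebraMap_iff_fixed (k := k) (f.1 ())).2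
      fun g => (f.2 g ()).symm
    exact ⟨c, Subtype.ext (funext fun _ => hc)⟩⟩

theorem map_evalAt_fullBaseEquiv (e : (L →ₐ[k] Ω) ≃ Fin n) {J : Type*} (x : (full e).base.carrier)
    (f : MvPolynomial J k) :
    MvPolynomial.map (Frame.evalAt (full e).base x : _ →+* Ω)
      (MvPolynomial.mapAlgEquiv J (fullBaseEquiv e) f) =
      MvPolynomial.map (algebraMap k Ω) f := by
  ext d
  rw [MvPolynomial.coeff_map, MvPolynomial.coeff_map, MvPolynomial.mapAlgEquiv_apply,
    MvPolynomial.coeff_map]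
  rfl

/-- A basis of `L` is a frame for the full set of embeddings. -/
theorem exists_frame_full (e : (L →ₐ[k] Ω) ≃ Fin n) {J : Type v} [Fintype J] [DecidableEq J]
    (b : Module.Basis J k L) (hJ : Fintype.card J = n) :
    ∃ F : (full e).Frame J, ∀ x, F.vec x = b := by
  obtain ⟨v, N, h, -⟩ := exists_invertible_conjugates e Finset.univ (Finset.card_fin n)
  let V : Matrix J (Fin n) Ω :=
    (Matrix.of fun i j => algebraMap k Ω (b.repr (v j) i)) * Matrix.of N
  have hUV : (Matrix.of fun s j => e.symm s (b j)) * V = 1 := by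
    rw [← Matrix.mul_assoc]
    ext s s'
    rw [Matrix.mul_apply, Matrix.one_apply, ← h s (Finset.mem_univ s) s' (Finset.mem_univ s')]
    refine Finset.sum_congr rfl fun j _ => ?_
    congr 1
    conv_rhs => rw [← b.sum_repr (v j), map_sum]
    rw [Matrix.mul_apply]
    refine Finset.sum_congr rfl fun i _ => ?_
    rw [map_smul, Algebra.smul_def, mul_comm]
    rfl
  have hVU : V * (Matrix.of fun s j => e.symm s (b j)) = 1 :=
    (Matrix.mul_eq_one_comm_of_equiv (Fintype.equivFinOfCardEq hJ).symm).1 hUV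
  refine ⟨⟨fun _ => b, fun _ => V, fun _ _ => rfl, fun _ s _ s' _ => ?_, fun _ j j' => ?_⟩,
    fun _ => rfl⟩
  · exact (congrFun (congrFun hUV s) s').trans Matrix.one_apply
  · exact (congrFun (congrFun hVU j) j').trans Matrix.one_apply

/-- Under the identification of the affine space `L` with `𝔸^n` by means of the embeddings, the
norm becomes the product of the coordinates, so that `L^*` is the torus of the full family. -/
theorem specClass_unitAlgebra (e : (L →ₐ[k] Ω) ≃ Fin n) (hL : Module.finrank k L = n) :
    specClass k (UnitAlgebra k L) = specClass k (full e).TorusAlgebra := by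
  classical
  let b := Module.Free.chooseBasis k L
  obtain ⟨F, hF⟩ := exists_frame_full e b (by rw [← hL, Module.finrank_eq_card_basis b])
  let ε : Coord k L ≃ₐ[k] (full e).coordRing :=
    (MvPolynomial.mapAlgEquiv _ (fullBaseEquiv e)).trans F.coordRingEquiv
  have hmap : ∀ x (f : Coord k L), F.toFrame x ((ε f).1 x) =
      MvPolynomial.map (algebraMap k Ω) f := fun x f => by
    have h1 : ε f = F.polyToCoordRing (MvPolynomial.mapAlgEquiv _ (fullBaseEquiv e) f) :=
      rfl
    rw [h1, F.toFrame_polyToCoordRing]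
    exact map_evalAt_fullBaseEquiv e x f
  have hε : ε (normForm k L) = (full e).esymm n := by
    refine Subtype.ext (funext fun x => ?_)
    have hinj : ∀ r : (full e).coordRing, F.ofFrame x (F.toFrame x (r.1 x)) = r.1 x :=
      fun r => by rw [← r.2.2 x, F.ofFrame_toFrame]
    rw [← hinj, ← hinj ((full e).esymm n), hmap, esymm_apply, map_prod]
    congr 1
    let φ : Coord k L →ₐ[k] MvPolynomial (Module.Free.ChooseBasisIndex k L) Ω :=
      MvPolynomial.mapAlgHom (Algebra.ofId k Ω)
    have hnorm := map_norm_tensor φ (genericElement k L)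
    change _ = MvPolynomial.map (algebraMap k Ω) (normForm k L) at hnorm
    rw [← hnorm, norm_eq_prod_conjugates e.symm b (Matrix.of (F.inv x))]
    · refine Finset.prod_congr rfl fun s _ => ?_
      rw [F.toFrame_X, hF]
      simp only [genericElement, map_sum, Algebra.TensorProduct.map_tmul,
        Algebra.TensorProduct.lift_tmul]
      refine Finset.sum_congr rfl fun j _ => ?_
      rw [mul_comm]
      simp [φ, b, MvPolynomial.algebraMap_eq]
    · ext s s'
      have h := F.vec_inv x s (Finset.mem_univ s) s' (Finset.mem_univ s')
      rw [hF] at h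
      exact h.trans Matrix.one_apply.symm
    · ext j j'
      have h := F.inv_vec x j j'
      rw [hF] at h
      exact h.trans Matrix.one_apply.symm
  have h := specClass_away_eq (ε : Coord k L →ₐ[k] (full e).coordRing) (normForm k L)
    (fun c => ε.surjective _) fun a ha => by
      rw [show a = 0 from ε.injective (ha.trans (map_zero ε).symm), mul_zero]
      exact IsNilpotent.zero
  exact h.trans (by rw [show (ε : Coord k L →ₐ[k] (full e).coordRing) (normForm k L) = _ from hε])

end SubsetFamily
end

/-! ### The coefficients as elements of the Burnside ring -/

section

variable {k : Type u} [Field k] {Ω : Type u} [Field Ω] [Algebra k Ω] [IsSepClosure k Ω]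
  {L : Type u} [CommRing L] [Algebra k L] [Module.Finite k L] {n : ℕ}
  {e : (L →ₐ[k] Ω) ≃ Fin n} {m : ℕ}

namespace SubsetFamily

/-- The class of the bundle of tori given by a family of subsets. -/
def torusClass (X : SubsetFamily e m) : K0Var k := specClass k X.TorusAlgebra

/-- For `i = 0` the points of `zeroFamily` are the pairs `(b, ∅)`, so that nothing changes. -/
theorem torusClass_zeroFamily_zero (X : SubsetFamily e m) :
    (X.zeroFamily 0).torusClass = X.torusClass := by
  unfold torusClass
  have h := specClass_away_eq (X.restrictZero 0) (X.esymm m) (fun c => ?_) fun a ha => ?_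
  · rw [h, restrictZero_esymm]
    rfl
  · rw [restrictZero_esymm]
    exact X.exists_restrictZero_eq 0 c
  · have h1 := X.mul_mem_radical_of_restrictZero_eq_zero (Nat.zero_le m) a ha
    rw [zeroIdeal_zero] at h1
    exact mem_nilradical.1 h1

/-- The `G`-set of all tuples `(b, Z_1, …, Z_t)`, where the `Z_j` are disjoint subsets of `X.sub b`
with prescribed numbers of elements. -/
def chains : List ℕ → {m : ℕ} → SubsetFamily e m → FinGSet Gal(Ω/k)
  | [], _, X => X.base
  | i :: l, _, X => chains l (X.zeroFamily i)

/-- The coefficient of `𝕃 ^ (m - l)` in the class of the bundle of tori given by `X`: the analogue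
of `ρ_l` over the base of `X`. -/
def coeff (X : SubsetFamily e m) (l : ℕ) : K0Var k :=
  ∑ α : Composition l, (-1) ^ α.blocks.length * art k Ω (chains α.blocks X).cls

theorem coeff_zero (X : SubsetFamily e m) : X.coeff 0 = art k Ω X.base.cls := by
  have h : ∀ α : Composition 0, α.blocks = [] := fun α => α.blocks_eq_nil.2 rfl
  rw [coeff, Fintype.sum_eq_single (default : Composition 0)
    fun α hα => absurd (Composition.ext ((h α).trans (h _).symm)) hα, h, List.length_nil,
    pow_zero, one_mul]
  rfl

/-- The first subset of a chain is split off, according to its number `i + 1` of elements. -/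
theorem coeff_succ (X : SubsetFamily e m) (l : ℕ) :
    X.coeff (l + 1) = -∑ i ∈ Finset.range (l + 1), (X.zeroFamily (i + 1)).coeff (l - i) := by
  rw [coeff, sum_composition_succ fun b => (-1) ^ b.length * art k Ω (chains b X).cls,
    ← Finset.sum_neg_distrib]
  refine Finset.sum_congr rfl fun i _ => ?_
  rw [coeff, ← Finset.sum_neg_distrib]
  refine Finset.sum_congr rfl fun β _ => ?_
  rw [List.length_cons, pow_succ, mul_neg_one, neg_mul]
  rfl

/-- The stratification by the number of vanishing coordinates expresses the class of the torus by
the classes of the tori of smaller rank over `zeroFamily (i + 1)`; the coefficients satisfy the same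
recursion. -/
theorem torusClass_eq_sum (X : SubsetFamily e m) : X.torusClass =
    ∑ l ∈ Finset.range (m + 1), X.coeff l * lefschetz k ^ (m - l) := by
  induction m using Nat.strong_induction_on with
  | _ m ih =>
    have h : ∑ i ∈ Finset.range (m + 1), (X.zeroFamily i).torusClass = _ :=
      X.sum_specClass_torusAlgebra
    rw [Finset.sum_range_succ', torusClass_zeroFamily_zero] at h
    rw [eq_sub_of_add_eq' h, Finset.sum_range_succ', coeff_zero, Nat.sub_zero, sub_eq_add_neg,
      add_comm]
    congr 1
    rw [← Finset.sum_neg_distrib]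
    have h1 : ∀ i ∈ Finset.range m, -(X.zeroFamily (i + 1)).torusClass =
        ∑ j ∈ Finset.range (m - i), -((X.zeroFamily (i + 1)).coeff j *
          lefschetz k ^ (m - (i + j + 1))) := fun i hi => by
      have hi := Finset.mem_range.1 hi
      rw [ih (m - (i + 1)) (by omega), ← Finset.sum_neg_distrib]
      refine Finset.sum_congr (by congr 1; omega) fun j _ => ?_
      congr 3
      omega
    have h2 : ∀ l ∈ Finset.range m, X.coeff (l + 1) * lefschetz k ^ (m - (l + 1)) =
        ∑ i ∈ Finset.range (l + 1), -((X.zeroFamily (i + 1)).coeff (l - i) *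
          lefschetz k ^ (m - (l + 1))) := fun l _ => by
      rw [coeff_succ, neg_mul, Finset.sum_mul, Finset.sum_neg_distrib]
    rw [Finset.sum_congr rfl h1, Finset.sum_congr rfl h2, Finset.sum_sigma', Finset.sum_sigma']
    refine Finset.sum_bij' (fun x _ => ⟨x.1 + x.2, x.1⟩) (fun x _ => ⟨x.2, x.1 - x.2⟩)
      ?_ ?_ ?_ ?_ ?_
    · rintro ⟨i, j⟩ hx
      simp only [Finset.mem_sigma, Finset.mem_range] at hx ⊢
      omega
    · rintro ⟨i, j⟩ hx
      simp only [Finset.mem_sigma, Finset.mem_range] at hx ⊢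
      omega
    · rintro ⟨i, j⟩ hx
      simp
    · rintro ⟨i, j⟩ hx
      simp only [Finset.mem_sigma, Finset.mem_range] at hx
      simp only [Sigma.mk.injEq, heq_eq_eq, and_true]
      omega
    · rintro ⟨i, j⟩ hx
      simp

/-- The element `b` of the base and the list `Z_1, …, Z_t` of subsets of which a point of
`chains l X` consists. -/
def chainData : (l : List ℕ) → {m : ℕ} → (X : SubsetFamily e m) → (chains l X).carrier →
    X.base.carrier × List (Finset (Fin n))
  | [], _, _, x => (x, [])
  | i :: l, _, X, x =>
    ((chainData l (X.zeroFamily i) x).1.1.1,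
      (chainData l (X.zeroFamily i) x).1.1.2 :: (chainData l (X.zeroFamily i) x).2)

theorem chainData_smul (l : List ℕ) {m : ℕ} (X : SubsetFamily e m) (g : Gal(Ω/k))
    (x : (chains l X).carrier) : chainData l X (g • x) = (g • (chainData l X x).1,
      (chainData l X x).2.map fun Z => Z.map (galoisToPerm e g).toEmbedding) := by
  induction l generalizing m X with
  | nil => rfl
  | cons i l ih =>
    exact congrArg (fun y => (y.1.1.1, y.1.1.2 :: y.2)) (ih (X.zeroFamily i) x)

theorem chainData_injective (l : List ℕ) {m : ℕ} (X : SubsetFamily e m) :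
    Function.Injective (chainData l X) := by
  induction l generalizing m X with
  | nil => exact fun x y h => congrArg Prod.fst h
  | cons i l ih =>
    intro x y h
    obtain ⟨h1, h2⟩ := Prod.ext_iff.1 h
    obtain ⟨h2, h3⟩ := List.cons.inj h2
    exact ih (X.zeroFamily i) (Prod.ext (Subtype.ext (Prod.ext h1 h2)) h3)

/-- The points of `chains` are exactly the tuples of disjoint subsets with the given numbers of
elements. -/
theorem range_chainData (l : List ℕ) {m : ℕ} (X : SubsetFamily e m) :
    Set.range (chainData l X) = {y | y.2.map Finset.card = l ∧ y.2.Pairwise Disjoint ∧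
      ∀ Z ∈ y.2, Z ⊆ X.sub y.1} := by
  induction l generalizing m X with
  | nil =>
    ext ⟨b, T⟩
    constructor
    · rintro ⟨x, hx⟩
      obtain ⟨rfl, rfl⟩ := Prod.ext_iff.1 hx
      simp [chainData]
    · rintro ⟨h, -, -⟩
      exact ⟨b, Prod.ext rfl (List.map_eq_nil_iff.1 h).symm⟩
  | cons i l ih =>
    ext ⟨b, T⟩
    constructor
    · rintro ⟨x, hx⟩
      obtain ⟨h1, h2⟩ := Prod.ext_iff.1 hx
      subst h1 h2
      have h : chainData l (X.zeroFamily i) x ∈ _ := (ih (X.zeroFamily i)).le ⟨x, rfl⟩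
      obtain ⟨h1, h2, h3⟩ := h
      obtain ⟨h4, h5⟩ := Finset.mem_powersetCard.1 (chainData l (X.zeroFamily i) x).1.2
      refine ⟨?_, ?_, ?_⟩
      · exact congrArg₂ List.cons h5 h1
      · refine List.pairwise_cons.2 ⟨fun Z hZ => ?_, h2⟩
        exact (Finset.sdiff_disjoint.mono_left (h3 Z hZ)).symm
      · rintro Z hZ
        rcases List.mem_cons.1 hZ with rfl | hZ
        · exact h4
        · exact (h3 Z hZ).trans Finset.sdiff_subset
    · rintro ⟨h1, h2, h3⟩
      cases T with
      | nil => exact absurd h1 (List.cons_ne_nil _ _).symm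
      | cons Z T =>
        obtain ⟨h4, h5⟩ := List.cons.inj h1
        obtain ⟨h6, h7⟩ := List.pairwise_cons.1 h2
        have hZ := h3 Z List.mem_cons_self
        let b' : (X.zeroFamily i).base.carrier := ⟨(b, Z), Finset.mem_powersetCard.2 ⟨hZ, h4⟩⟩
        obtain ⟨x, hx⟩ := (ih (X.zeroFamily i)).ge (show (b', T) ∈ _ from ⟨h5, h7, fun Z' hZ' =>
          Finset.subset_sdiff.2 ⟨h3 Z' (List.mem_cons_of_mem _ hZ'), (h6 Z' hZ').symm⟩⟩)
        refine ⟨x, ?_⟩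
        change ((chainData l (X.zeroFamily i) x).1.1.1,
          (chainData l (X.zeroFamily i) x).1.1.2 :: (chainData l (X.zeroFamily i) x).2) = _
        rw [hx]

/-- For the full set of embeddings, `chains` is the `G`-set of families of disjoint subsets,
restricted to the Galois group. -/
theorem chains_full_iso (e : (L →ₐ[k] Ω) ≃ Fin n) {i : ℕ} (α : Composition i) :
    (chains α.blocks (full e)).Iso
      (((standardSet n).disjointSubsets α).restrict (galoisToPerm e)) := by
  have hdata : ∀ x : (chains α.blocks (full e)).carrier,
      (chainData α.blocks (full e) x).2.map Finset.card = α.blocks ∧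
      (chainData α.blocks (full e) x).2.Pairwise Disjoint := fun x => by
    obtain ⟨h1, h2, -⟩ := (range_chainData α.blocks (full e)).le ⟨x, rfl⟩
    exact ⟨h1, h2⟩
  have hlen : ∀ x : (chains α.blocks (full e)).carrier,
      (chainData α.blocks (full e) x).2.length = α.length := fun x => by
    rw [← List.length_map (f := Finset.card), (hdata x).1]
  let f : (chains α.blocks (full e)).carrier → (standardSet n).DisjointFamily α := fun x =>
    ⟨fun j => ((chainData α.blocks (full e) x).2.get (j.cast (hlen x).symm) : Set (Fin n)), by
      refine ⟨fun j => ?_, fun j j' hj => ?_⟩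
      · refine (Set.ncard_coe_finset _).trans ?_
        have h := List.getElem_of_eq (hdata x).1 (i := j) (by
          rw [List.length_map, hlen x]
          exact j.2)
        rw [List.getElem_map] at h
        exact h
      · refine Finset.disjoint_coe.2 ?_
        have h := List.pairwise_iff_get.1 (hdata x).2
        rcases lt_or_gt_of_ne hj with hj | hj
        · exact h _ _ hj
        · exact (h _ _ hj).symm⟩
  have hsurj : ∀ T : Fin α.length → Set (Fin n), (∀ j, (T j).ncard = α.blocksFun j) →
      (Pairwise fun j l => Disjoint (T j) (T l)) → ∃ x : (chains α.blocks (full e)).carrier,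
        ∀ j, ((chainData α.blocks (full e) x).2.get (j.cast (hlen x).symm) : Set (Fin n)) =
          T j := by
    intro T hT1 hT2
    obtain ⟨l, hl⟩ : ∃ l, l = List.ofFn fun j => (Set.toFinite (T j)).toFinset := ⟨_, rfl⟩
    have h1 : l.map Finset.card = α.blocks := by
      rw [hl, List.map_ofFn, ← Composition.ofFn_blocksFun]
      congr 1
      funext j
      rw [← hT1 j, Function.comp_apply, Set.ncard_eq_toFinset_card]
    have h2 : l.Pairwise Disjoint := by
      rw [hl, List.pairwise_ofFn]
      exact fun j j' hj => by
        rw [Set.Finite.disjoint_toFinset]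
        exact hT2 hj.ne
    obtain ⟨x, hx⟩ := (range_chainData α.blocks (full e)).ge
      (show (((), l) : Unit × _) ∈ _ from ⟨h1, h2, fun Z _ => Finset.subset_univ Z⟩)
    refine ⟨x, fun j => ?_⟩
    have h3 : (chainData α.blocks (full e) x).2 = l := congrArg Prod.snd hx
    rw [List.get_eq_getElem, List.getElem_of_eq h3, List.getElem_of_eq hl]
    simp
  have hf : Function.Bijective f := by
    constructor
    · intro x y h
      apply chainData_injective α.blocks (full e)
      refine Prod.ext rfl ?_
      refine List.ext_get ((hlen x).trans (hlen y).symm) fun j h1 h2 => ?_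
      have := congrFun (congrArg Subtype.val h) ⟨j, (hlen x) ▸ h1⟩
      exact Finset.coe_injective this
    · rintro ⟨T, hT1, hT2⟩
      obtain ⟨x, hx⟩ := hsurj T hT1 hT2
      exact ⟨x, Subtype.ext (funext hx)⟩
  refine ⟨Equiv.ofBijective f hf, fun g x => ?_⟩
  refine Subtype.ext (funext fun j => ?_)
  change ((chainData α.blocks (full e) (g • x)).2.get (j.cast (hlen (g • x)).symm) : Set (Fin n)) =
    galoisToPerm e g • ((chainData α.blocks (full e) x).2.get (j.cast (hlen x).symm) : Set (Fin n))
  have h2 := congrArg Prod.snd (chainData_smul α.blocks (full e) g x)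
  rw [List.get_eq_getElem, List.getElem_of_eq h2, List.getElem_map, Finset.coe_map]
  rfl

theorem art_neg_one_pow_mul (N : ℕ) (c : BurnsideRing Gal(Ω/k)) :
    art k Ω ((-1) ^ N * c) = (-1) ^ N * art k Ω c := by
  induction N with
  | zero => simp
  | succ N ih =>
    rw [pow_succ', pow_succ', mul_assoc, mul_assoc, neg_one_mul, neg_one_mul, map_neg, ih]

theorem specClass_self (k : Type u) [Field k] : specClass k k = 1 := by
  have h : (1 : K0Var k) = K0Var.mk (𝟙_ (Variety k)) := by
    rw [K0Var.mk, ← Skeleton.one_eq, ← FreeAbelianGroup.one_def, map_one]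
  have hid : Spec.map (CommRingCat.ofHom (algebraMap k k)) = 𝟙 (Spec (CommRingCat.of k)) :=
    Spec.map_id (CommRingCat.of k)
  let i : Over.mk (Spec.map (CommRingCat.ofHom (algebraMap k k))) ≅
      Over.mk (𝟙 (Spec (CommRingCat.of k))) := eqToIso (congrArg Over.mk hid)
  let j : (specVariety k k).obj ≅ (𝟙_ (Variety k)).obj := i
  rw [h]
  exact K0Var.mk_eq_of_iso ((finiteTypeOver k).isoMk j)

theorem art_full_base (e : (L →ₐ[k] Ω) ≃ Fin n) : art k Ω (full e).base.cls = 1 := by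
  rw [art_cls, ← specClass_self]
  exact (specClass_congr (fullBaseEquiv e)).symm

theorem art_res_rho (e : (L →ₐ[k] Ω) ≃ Fin n) (i : ℕ) :
    art k Ω (res (galoisToPerm e) (rho n i)) = (full e).coeff i := by
  rw [rho, map_sum, map_sum, coeff]
  refine Finset.sum_congr rfl fun α _ => ?_
  rw [map_mul, map_pow, map_neg, map_one, res_cls, ← cls_eq_of_iso (chains_full_iso e α)]
  exact art_neg_one_pow_mul _ _

end SubsetFamily

/-- The number of embeddings of an étale algebra into a separable closure is its dimension. -/
theorem nonempty_embeddings_equiv [Algebra.Etale k L] (hL : Module.finrank k L = n) :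
    Nonempty ((L →ₐ[k] Ω) ≃ Fin n) := by
  have : IsSepClosed Ω := IsSepClosure.sep_closed k
  let E := Algebra.FormallyEtale.equivPiOfIsSepClosed Ω (Ω ⊗[k] L)
  have : IsArtinianRing (Ω ⊗[k] L) := isArtinian_of_tower Ω inferInstance
  have := Fintype.ofFinite (PrimeSpectrum (Ω ⊗[k] L))
  have hcard : Nat.card (PrimeSpectrum (Ω ⊗[k] L)) = n := by
    rw [Nat.card_eq_fintype_card, ← Module.finrank_fintype_fun_eq_card Ω,
      ← LinearEquiv.finrank_eq E.toLinearEquiv, Module.finrank_baseChange, hL]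
  let ev : PrimeSpectrum (Ω ⊗[k] L) → (L →ₐ[k] Ω) := fun p =>
    ((Pi.evalAlgHom Ω (fun _ => Ω) p).comp E.toAlgHom).restrictScalars k |>.comp
      Algebra.TensorProduct.includeRight
  have hev : Function.Injective ev := fun p q hpq => by
    classical
    have h : (Pi.evalAlgHom Ω (fun _ => Ω) p).comp E.toAlgHom =
        (Pi.evalAlgHom Ω (fun _ => Ω) q).comp E.toAlgHom :=
      Algebra.TensorProduct.ext (Subsingleton.elim _ _) hpq
    by_contra hne
    have h1 := DFunLike.congr_fun h (E.symm (Pi.single p 1))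
    simp [Ne.symm hne] at h1
  have hfin : Finite (L →ₐ[k] Ω) := Cardinal.mk_lt_aleph0_iff.1
    ((cardinalMk_algHom k L Ω).trans_lt (Cardinal.natCast_lt_aleph0))
  have := Fintype.ofFinite (L →ₐ[k] Ω)
  have hle := (linearIndependent_toLinearMap k L Ω).fintype_card_le_finrank
  rw [Module.finrank_linearMap_self, hL, ← Nat.card_eq_fintype_card] at hle
  exact ⟨Finite.equivFinOfCardEq
    (le_antisymm hle (hcard ▸ Nat.card_le_card_of_injective ev hev))⟩

end

end ArtinClasses

end

theorem theorem111 (n : ℕ) (hn : 0 < n)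
    (k : Type u) [Field k] (Ω : Type u) [Field Ω] [Algebra k Ω] [IsSepClosure k Ω]
    (L : Type u) [CommRing L] [Algebra k L] [Module.Finite k L] [Algebra.Etale k L]
    (hL : Module.finrank k L = n) :
    Nonempty ((L →ₐ[k] Ω) ≃ Fin n) ∧
    ∀ e : (L →ₐ[k] Ω) ≃ Fin n,
      GrothendieckVar.K0Var.mk (UnitTorus.unitTorus k L) =
        GrothendieckVar.lefschetz k ^ n +
          ∑ i ∈ Finset.Icc 1 n,
            ArtinClasses.art k Ω
                (Burnside.res (ArtinClasses.galoisToPerm e) (Burnside.rho n i)) *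
              GrothendieckVar.lefschetz k ^ (n - i) := by
  refine ⟨ArtinClasses.nonempty_embeddings_equiv hL, fun e => ?_⟩
  have h1 : GrothendieckVar.K0Var.mk (UnitTorus.unitTorus k L) = _ :=
    (ArtinClasses.SubsetFamily.specClass_unitAlgebra e hL).trans
      (ArtinClasses.SubsetFamily.torusClass_eq_sum _)
  have h0 : ArtinClasses.art k Ω (ArtinClasses.SubsetFamily.full e).base.cls = 1 :=
    ArtinClasses.SubsetFamily.art_full_base e
  rw [h1, Finset.sum_range_succ', ArtinClasses.SubsetFamily.coeff_zero, h0, one_mul, Nat.sub_zero,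
    add_comm]
  congr 1
  rw [← Finset.Ico_add_one_right_eq_Icc, Finset.sum_Ico_eq_sum_range, Nat.add_sub_cancel]
  refine Finset.sum_congr rfl fun i _ => ?_
  rw [ArtinClasses.SubsetFamily.art_res_rho, add_comm 1 i]
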